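/- Let $W$ be a finite Coxeter group with simple reflections $s_1,\dots,s_n$, length function $\ell(\cdot)$ and longest element $w_0$. For $q\ge 1$ let $H_q$ be the Iwahori–Hecke algebra over $\mathbb C$ with basis $\{T_w\}_{w\in W}$ and multiplication $T_{s_i}T_w=T_{s_iw}$ if $\ell(s_iw)>\ell(w)$, $T_{s_i}T_w=(q-1)T_w+qT_{s_iw}$ if $\ell(s_iw)<\ell(w)$, and put $\tilde T_w=q^{-\ell(w)}T_w$. Let $P_W(q)=\sum_{w\in W}q^{\ell(w)}$. Let $\hat W$ index the irreducible complex characters $\chi^\lambda_W$ of $W$, with $\lambda=\mathbf 1$ the trivial one, and let $d_\lambda=\chi^\lambda_W(1)$ and $c_\lambda=\chi^\lambda_W(z)/d_\lambda$, where $z$ is the sum of all reflections of $W$. There is exactly one family of bijections $\lambda\mapsto\chi^{\lambda}_{q}$ $(q\ge 1)$ from $\hat W$ onto the irreducible characters of $H_q$ such that, for all $\lambda$ and $w$, $\chi^\lambda_q(T_w)$ is continuous in $q\in[1,\infty)$ and $\chi^\lambda_q(T_w)|_{q=1}=\chi^\lambda_W(w)$. The generic degrees $t_\lambda$ at the parameter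 $q$ are the (uniquely determined) numbers with $\vec t=\sum_{\lambda}t_\lambda\chi^\lambda_q$, where $\vec t\colon H_q\to\mathbb C$ is the linear functional with $\vec t(T_1)=P_W(q)$ and $\vec t(T_w)=0$ for $w\ne 1$. Fix $0<\theta\le 1$, let $q=\theta^{-1}$ and $\pi(w)=\theta^{-\ell(w)}/P_W(\theta^{-1})$. Let $K$ be the matrix of left multiplication by $\tilde T_{w_0}^2$ on the basis $\{\tilde T_w\}$, i.e. $\tilde T_{w_0}^2\tilde T_x=\sum_{y}K(x,y)\tilde T_y$. Then $K$ is the transition matrix of a Markov chain on $W$ that is reversible with respect to the probability distribution $\pi$. Write $K_x^m(y)=K^m(x,y)$ and $\|f\|_2^2=\sum_{y\in W}f(y)^2\pi(y)$. For every integer $m\ge 0$, $$\text{(a)}\quad \Big\|\frac{K_1^m}{\pi}-1\Big\|_2^2=\sum_{\lambda\ne\mathbf 1}t_\lambda d_\lambda\,\theta^{2m(\ell(w_0)-c_\lambda)},$$ $$\text{(b)}\quad \sum_{x\in W}\pi(x)\Big\|\frac{K_x^m}{\pi}-1\Big\|_2^2=\sum_{\lambda\ne\mathbf 1}d_\lambda^2\,\theta^{2m(\ell(w_0)-c_\lambda)}.$$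 -/

import Mathlib

/-! ### The exchange property of Coxeter groups (used for associativity of the Hecke algebra) -/

namespace CoxeterSystem

variable {B W : Type*} [Group W] {M : CoxeterMatrix B} (cs : CoxeterSystem M W)

/-- The involution `(t, ε) ↦ (s t s, ε + [t = s])` of `W × ℤ/2` attached to a simple
reflection `s`. -/
noncomputable def reflFlip (i : B) : Equiv.Perm (W × ZMod 2) := by
  classical
  exact
  { toFun := fun p => (cs.simple i * p.1 * cs.simple i, p.2 + if p.1 = cs.simple i then 1 else 0)
    invFun := fun p => (cs.simple i * p.1 * cs.simple i, p.2 + if p.1 = cs.simple i then 1 else 0)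
    left_inv := by
      rintro ⟨t, e⟩
      have h : cs.simple i * t * cs.simple i = cs.simple i ↔ t = cs.simple i := by
        constructor
        · intro h
          have := congrArg (fun x => cs.simple i * x * cs.simple i) h
          simpa [mul_assoc] using this
        · rintro rfl; simp
      ext
      · simp [mul_assoc]
      · simp only [h]
        rw [add_assoc, CharTwo.add_self_eq_zero, add_zero]
    right_inv := by
      rintro ⟨t, e⟩
      have h : cs.simple i * t * cs.simple i = cs.simple i ↔ t = cs.simple i := by
        constructor
        · intro h
          have := congrArg (fun x => cs.simple i * x * cs.simple i) h
          simpa [mul_assoc] using this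
        · rintro rfl; simp
      ext
      · simp [mul_assoc]
      · simp only [h]
        rw [add_assoc, CharTwo.add_self_eq_zero, add_zero] }

open Classical in
theorem reflFlip_apply (i : B) (t : W) (e : ZMod 2) :
    cs.reflFlip i (t, e) =
      (cs.simple i * t * cs.simple i, e + if t = cs.simple i then 1 else 0) := by
  simp only [reflFlip, Equiv.coe_fn_mk]

open Classical in
theorem reflFlip_pow (i j : B) (n : ℕ) (t : W) (e : ZMod 2) :
    ((cs.reflFlip i * cs.reflFlip j) ^ n) (t, e) =
      ((cs.simple i * cs.simple j) ^ n * t * (cs.simple j * cs.simple i) ^ n,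
        e + ∑ k ∈ Finset.range (2 * n),
          if t = (cs.simple j * cs.simple i) ^ k * cs.simple j then 1 else 0) := by
  induction n with
  | zero => simp
  | succ n ih =>
    set a := cs.simple i
    set b := cs.simple j
    have ha : a * a = 1 := cs.simple_mul_simple_self i
    have hb : b * b = 1 := cs.simple_mul_simple_self j
    have hinv : (a * b) ^ n * (b * a) ^ n = 1 := by
      have : b * a = (a * b)⁻¹ := by
        rw [mul_inv_rev, cs.inv_simple, cs.inv_simple]
      rw [this, inv_pow, mul_inv_cancel]
    have hinv' : (b * a) ^ n * (a * b) ^ n = 1 := by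
      have : b * a = (a * b)⁻¹ := by
        rw [mul_inv_rev, cs.inv_simple, cs.inv_simple]
      rw [this, inv_pow, inv_mul_cancel]
    have hslide : ∀ m : ℕ, b * (a * b) ^ m = (b * a) ^ m * b := by
      intro m
      induction m with
      | zero => simp
      | succ m ihm => rw [pow_succ, ← mul_assoc, ihm, pow_succ]; simp only [mul_assoc]
    have key1 : (a * b) ^ n * t * (b * a) ^ n = b ↔ t = (b * a) ^ (2 * n) * b := by
      rw [two_mul, pow_add, mul_assoc _ _ b, ← hslide]
      constructor
      · intro h
        calc t = ((b * a) ^ n * (a * b) ^ n) * t * ((b * a) ^ n * (a * b) ^ n) := by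
              rw [hinv']; simp
          _ = (b * a) ^ n * ((a * b) ^ n * t * (b * a) ^ n) * (a * b) ^ n := by
              simp only [mul_assoc]
          _ = _ := by rw [h]; simp only [mul_assoc]
      · intro h
        calc (a * b) ^ n * t * (b * a) ^ n
            = ((a * b) ^ n * (b * a) ^ n) * b * ((a * b) ^ n * (b * a) ^ n) := by
              rw [h]; simp only [mul_assoc]
          _ = b := by rw [hinv]; simp
    have key2 : b * ((a * b) ^ n * t * (b * a) ^ n) * b = a ↔
        t = (b * a) ^ (2 * n + 1) * b := by
      have e1 : (b * a) ^ (2 * n + 1) * b = (b * a) ^ n * (b * a * b) * (a * b) ^ n := by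
        rw [show 2 * n + 1 = n + 1 + n by ring, pow_add, mul_assoc _ _ b, ← hslide, pow_succ]
        simp only [mul_assoc]
      rw [e1]
      constructor
      · intro h
        have h' : (a * b) ^ n * t * (b * a) ^ n = b * a * b := by
          calc (a * b) ^ n * t * (b * a) ^ n
              = (b * b) * ((a * b) ^ n * t * (b * a) ^ n) * (b * b) := by rw [hb]; simp
            _ = b * (b * ((a * b) ^ n * t * (b * a) ^ n) * b) * b := by simp only [mul_assoc]
            _ = b * a * b := by rw [h]
        calc t = ((b * a) ^ n * (a * b) ^ n) * t * ((b * a) ^ n * (a * b) ^ n) := by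
              rw [hinv']; simp
          _ = (b * a) ^ n * ((a * b) ^ n * t * (b * a) ^ n) * (a * b) ^ n := by
              simp only [mul_assoc]
          _ = _ := by rw [h']
      · intro h
        calc b * ((a * b) ^ n * t * (b * a) ^ n) * b
            = b * (((a * b) ^ n * (b * a) ^ n) * (b * a * b) * ((a * b) ^ n * (b * a) ^ n)) * b := by
              rw [h]; simp only [mul_assoc]
          _ = (b * b) * a * (b * b) := by rw [hinv]; simp only [mul_assoc, one_mul, mul_one]
          _ = a := by rw [hb]; simp
    rw [pow_succ', Equiv.Perm.mul_apply, ih, Equiv.Perm.mul_apply, reflFlip_apply,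
      reflFlip_apply]
    rw [show 2 * (n + 1) = 2 * n + 1 + 1 by ring, Finset.sum_range_succ, Finset.sum_range_succ]
    ext
    · change a * (b * _ * b) * a = _
      rw [pow_succ' (a * b), pow_succ (b * a)]
      simp only [mul_assoc]
    · change _ + (if (a * b) ^ n * t * (b * a) ^ n = b then (1 : ZMod 2) else 0) +
        (if b * ((a * b) ^ n * t * (b * a) ^ n) * b = a then (1 : ZMod 2) else 0) = _
      simp only [key1, key2, add_assoc]

theorem reflFlip_isLiftable : M.IsLiftable cs.reflFlip := by
  classical
  intro i j
  ext1 ⟨t, e⟩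
  rw [reflFlip_pow, cs.simple_mul_simple_pow, cs.simple_mul_simple_pow']
  have h : ∑ k ∈ Finset.range (2 * M.M i j),
      (if t = (cs.simple j * cs.simple i) ^ k * cs.simple j then (1 : ZMod 2) else 0) = 0 := by
    rw [two_mul, Finset.sum_range_add]
    simp only [pow_add, cs.simple_mul_simple_pow', one_mul]
    exact CharTwo.add_self_eq_zero _
  simp [h]

/-- The action of `W` on `W × ℤ/2` extending the involutions of the simple reflections. -/
noncomputable def reflAction : W →* Equiv.Perm (W × ZMod 2) :=
  cs.lift ⟨cs.reflFlip, cs.reflFlip_isLiftable⟩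

/-- The parity of the number of occurrences of `t` in the right inversion sequence of any word
for `w`. -/
noncomputable def invParity (w t : W) : ZMod 2 := (cs.reflAction w (t, 0)).2

open Classical in
theorem reflAction_apply (w t : W) (e : ZMod 2) :
    cs.reflAction w (t, e) = (w * t * w⁻¹, e + cs.invParity w t) := by
  induction w using cs.simple_induction_left generalizing t e with
  | one => simp [invParity]
  | mul_simple_left w i ih =>
    have h : ∀ e, cs.reflAction (cs.simple i * w) (t, e) = (cs.simple i * (w * t * w⁻¹) * cs.simple i,
        e + cs.invParity w t + if w * t * w⁻¹ = cs.simple i then 1 else 0) := by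
      intro e
      rw [map_mul, Equiv.Perm.mul_apply, ih]
      rw [show cs.reflAction (cs.simple i) = cs.reflFlip i from
        cs.lift_apply_simple cs.reflFlip_isLiftable i]
      rw [reflFlip_apply]
    rw [invParity, h, h]
    ext
    · simp [mul_assoc]
    · simp [add_assoc]

open Classical in
theorem invParity_simple_mul (w t : W) (i : B) : cs.invParity (cs.simple i * w) t =
    cs.invParity w t + if w * t * w⁻¹ = cs.simple i then 1 else 0 := by
  rw [invParity, map_mul, Equiv.Perm.mul_apply, reflAction_apply cs w]
  rw [show cs.reflAction (cs.simple i) = cs.reflFlip i from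
        cs.lift_apply_simple cs.reflFlip_isLiftable i, reflFlip_apply]
  simp

theorem invParity_mul_simple (w : W) (i : B) :
    cs.invParity (w * cs.simple i) (cs.simple i) = 1 + cs.invParity w (cs.simple i) := by
  rw [invParity, map_mul, Equiv.Perm.mul_apply]
  rw [show cs.reflAction (cs.simple i) = cs.reflFlip i from
        cs.lift_apply_simple cs.reflFlip_isLiftable i, reflFlip_apply]
  simp [reflAction_apply]

theorem mem_rightInvSeq_of_invParity_ne_zero (ω : List B) (t : W)
    (h : cs.invParity (cs.wordProd ω) t ≠ 0) : t ∈ cs.rightInvSeq ω := by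
  classical
  induction ω with
  | nil => simp [invParity] at h
  | cons i ω ih =>
    rw [cs.wordProd_cons, invParity_simple_mul] at h
    rw [rightInvSeq, List.mem_cons]
    by_cases h1 : cs.invParity (cs.wordProd ω) t = 0
    · left
      by_cases h2 : cs.wordProd ω * t * (cs.wordProd ω)⁻¹ = cs.simple i
      · rw [← h2]; simp [mul_assoc]
      · simp [h1, h2] at h
    · exact Or.inr (ih h1)

theorem length_mul_lt_of_invParity_ne_zero (w t : W) (h : cs.invParity w t ≠ 0) :
    cs.length (w * t) < cs.length w := by
  obtain ⟨ω, hω, rfl⟩ := cs.exists_isReduced w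
  exact (cs.isRightInversion_of_mem_rightInvSeq hω
    (cs.mem_rightInvSeq_of_invParity_ne_zero ω t h)).2

theorem invParity_simple_ne_zero_iff (w : W) (i : B) :
    cs.invParity w (cs.simple i) ≠ 0 ↔ cs.length (w * cs.simple i) < cs.length w := by
  refine ⟨cs.length_mul_lt_of_invParity_ne_zero w _, fun h h0 => ?_⟩
  have h1 := cs.length_mul_lt_of_invParity_ne_zero (w * cs.simple i) (cs.simple i)
    (by rw [invParity_mul_simple, h0]; decide)
  simp at h1
  omega

/-- If `s w` and `w t` are longer than `w` but `s w t` is shorter than `s w`,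
then `s w = w t`. -/
theorem simple_mul_eq_mul_simple (w : W) (i j : B)
    (h2 : cs.length w < cs.length (w * cs.simple j))
    (h3 : cs.length (cs.simple i * w * cs.simple j) < cs.length (cs.simple i * w)) :
    cs.simple i * w = w * cs.simple j := by
  classical
  have hp := (cs.invParity_simple_ne_zero_iff _ j).2 h3
  have hn : cs.invParity w (cs.simple j) = 0 := by
    by_contra h
    have := (cs.invParity_simple_ne_zero_iff _ j).1 h
    omega
  rw [invParity_simple_mul, hn, zero_add] at hp
  by_cases h : w * cs.simple j * w⁻¹ = cs.simple i
  · rw [← h]; simp [mul_assoc]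
  · simp [h] at hp

end CoxeterSystem

/-! ### The Iwahori–Hecke algebra -/

/-- The Iwahori–Hecke algebra with parameter `q` of a Coxeter system: the free module with
basis `T w`, `w ∈ W`. Its multiplication (`HeckeAlgebra.T_simple_mul_T`) is
`T s * T w = T (s w)` if `ℓ (s w) > ℓ w`, and `(q - 1) T w + q T (s w)` otherwise. -/
def HeckeAlgebra {B W R : Type*} [Group W] [CommRing R] {M : CoxeterMatrix B}
    (_cs : CoxeterSystem M W) (_q : R) : Type _ := W →₀ R

namespace HeckeAlgebra

variable {B W R : Type*} [Group W] [CommRing R] {M : CoxeterMatrix B}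
  (cs : CoxeterSystem M W) (q : R)

noncomputable instance : AddCommGroup (HeckeAlgebra cs q) :=
  inferInstanceAs (AddCommGroup (W →₀ R))

noncomputable instance : Module R (HeckeAlgebra cs q) :=
  inferInstanceAs (Module R (W →₀ R))

/-- The basis `T w`, `w ∈ W`. -/
noncomputable def basisT : Module.Basis W R (HeckeAlgebra cs q) :=
  Module.Basis.ofRepr (LinearEquiv.refl R (W →₀ R))

/-- The basis element `T w`. -/
noncomputable def T (w : W) : HeckeAlgebra cs q := basisT cs q w

/-- The operator of left multiplication by `T s`, `s` a simple reflection. -/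
noncomputable def opL (i : B) : HeckeAlgebra cs q →ₗ[R] HeckeAlgebra cs q :=
  (basisT cs q).constr R fun w =>
    if cs.length w < cs.length (cs.simple i * w) then T cs q (cs.simple i * w)
    else (q - 1) • T cs q w + q • T cs q (cs.simple i * w)

/-- The operator of right multiplication by `T s`, `s` a simple reflection. -/
noncomputable def opR (i : B) : HeckeAlgebra cs q →ₗ[R] HeckeAlgebra cs q :=
  (basisT cs q).constr R fun w =>
    if cs.length w < cs.length (w * cs.simple i) then T cs q (w * cs.simple i)
    else (q - 1) • T cs q w + q • T cs q (w * cs.simple i)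

theorem opL_T (i : B) (w : W) : opL cs q i (T cs q w) =
    if cs.length w < cs.length (cs.simple i * w) then T cs q (cs.simple i * w)
    else (q - 1) • T cs q w + q • T cs q (cs.simple i * w) := by
  rw [opL, T, Module.Basis.constr_basis]; rfl

theorem opR_T (i : B) (w : W) : opR cs q i (T cs q w) =
    if cs.length w < cs.length (w * cs.simple i) then T cs q (w * cs.simple i)
    else (q - 1) • T cs q w + q • T cs q (w * cs.simple i) := by
  rw [opR, T, Module.Basis.constr_basis]; rfl

theorem opL_opR (i j : B) (x : HeckeAlgebra cs q) :
    opL cs q i (opR cs q j x) = opR cs q j (opL cs q i x) := by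
  suffices h : opL cs q i ∘ₗ opR cs q j = opR cs q j ∘ₗ opL cs q i from LinearMap.congr_fun h x
  refine (basisT cs q).ext fun w => ?_
  change opL cs q i (opR cs q j (T cs q w)) = opR cs q j (opL cs q i (T cs q w))
  have l1 := cs.length_simple_mul w i
  have l2 := cs.length_mul_simple w j
  have l3 := cs.length_simple_mul (w * cs.simple j) i
  have l4 := cs.length_mul_simple (cs.simple i * w) j
  have eassoc : cs.simple i * (w * cs.simple j) = cs.simple i * w * cs.simple j :=
    (mul_assoc _ _ _).symm
  rw [eassoc] at l3
  rw [opL_T, opR_T]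
  by_cases a : cs.length w < cs.length (cs.simple i * w) <;>
  by_cases b : cs.length w < cs.length (w * cs.simple j)
  · rw [if_pos a, if_pos b, opL_T, opR_T, eassoc]
    by_cases d : cs.length (cs.simple i * w) < cs.length (cs.simple i * w * cs.simple j)
    · rw [if_pos d, if_pos (by omega)]
    · have := cs.simple_mul_eq_mul_simple w i j b (by omega)
      rw [if_neg d, if_neg (by omega), this]
  · rw [if_pos a, if_neg b, map_add, map_smul, map_smul, opL_T, opL_T, opR_T, if_pos a, eassoc,
      if_pos (by omega), if_neg (by omega)]
  · rw [if_neg a, if_pos b, map_add, map_smul, map_smul, opL_T, opR_T, opR_T, if_pos b, eassoc,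
      if_pos (show cs.length (cs.simple i * w) < _ by omega), if_neg (by omega)]
  · rw [if_neg a, if_neg b, map_add, map_smul, map_smul, map_add, map_smul, map_smul,
      opL_T, opR_T, opL_T, opR_T, eassoc, if_neg a, if_neg b]
    by_cases d : cs.length (cs.simple i * w) < cs.length (cs.simple i * w * cs.simple j)
    · have h := cs.simple_mul_eq_mul_simple (cs.simple i * w) i j d (by simp; omega)
      have h' : cs.simple i * w = w * cs.simple j := by
        have := congrArg (fun x => cs.simple i * x) h
        simpa [← mul_assoc] using this
      rw [if_pos d, if_pos (by omega), h']
    · rw [if_neg d, if_neg (by omega)]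
      module

/-- The product of the operators `opL` along a reduced word of `w`. -/
noncomputable def opLeft (w : W) : HeckeAlgebra cs q →ₗ[R] HeckeAlgebra cs q :=
  ((cs.exists_isReduced w).choose.map (opL cs q)).prod

/-- Left multiplication, as a linear map to endomorphisms. -/
noncomputable def lmul :
    HeckeAlgebra cs q →ₗ[R] (HeckeAlgebra cs q →ₗ[R] HeckeAlgebra cs q) :=
  (basisT cs q).constr R (opLeft cs q)

theorem prod_opL_T_one (ω : List B) (hω : cs.IsReduced ω) :
    ((ω.map (opL cs q)).prod : Module.End R (HeckeAlgebra cs q)) (T cs q 1) =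
      T cs q (cs.wordProd ω) := by
  induction ω with
  | nil => simp
  | cons i ω ih =>
    have h1 : cs.IsReduced ω := by simpa using hω.drop 1
    have h2 := hω.eq
    have h3 := h1.eq
    rw [cs.wordProd_cons, List.length_cons] at h2
    rw [List.map_cons, List.prod_cons, Module.End.mul_apply, ih h1, opL_T, cs.wordProd_cons,
      if_pos (by omega)]

theorem opLeft_T_one (w : W) : opLeft cs q w (T cs q 1) = T cs q w := by
  have h := (cs.exists_isReduced w).choose_spec
  rw [opLeft, prod_opL_T_one cs q _ h.1, ← h.2]

theorem lmul_T (w : W) : lmul cs q (T cs q w) = opLeft cs q w :=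
  Module.Basis.constr_basis _ _ _ _

theorem lmul_T_one (x : HeckeAlgebra cs q) : lmul cs q x (T cs q 1) = x := by
  suffices h : (lmul cs q).flip (T cs q 1) = LinearMap.id from LinearMap.congr_fun h x
  refine (basisT cs q).ext fun w => ?_
  change lmul cs q (T cs q w) (T cs q 1) = T cs q w
  rw [lmul_T, opLeft_T_one]

theorem lmul_opR (x y : HeckeAlgebra cs q) (j : B) :
    lmul cs q x (opR cs q j y) = opR cs q j (lmul cs q x y) := by
  suffices h : ((lmul cs q).flip (opR cs q j y)) = opR cs q j ∘ₗ (lmul cs q).flip y from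
    LinearMap.congr_fun h x
  refine (basisT cs q).ext fun w => ?_
  change lmul cs q (T cs q w) (opR cs q j y) = opR cs q j (lmul cs q (T cs q w) y)
  rw [lmul_T, opLeft]
  generalize (cs.exists_isReduced w).choose = ω
  induction ω with
  | nil => rfl
  | cons i ω ih =>
    rw [List.map_cons, List.prod_cons, Module.End.mul_apply, ih, Module.End.mul_apply, opL_opR]

/-- An operator commuting with all `opR` is determined by its value at `T 1`. -/
theorem eq_of_commute {f g : HeckeAlgebra cs q →ₗ[R] HeckeAlgebra cs q}
    (hf : ∀ j y, f (opR cs q j y) = opR cs q j (f y))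
    (hg : ∀ j y, g (opR cs q j y) = opR cs q j (g y))
    (h : f (T cs q 1) = g (T cs q 1)) : f = g := by
  refine (basisT cs q).ext fun w => ?_
  change f (T cs q w) = g (T cs q w)
  obtain ⟨ω, hω, rfl⟩ := cs.exists_isReduced w
  induction ω using List.reverseRecOn with
  | nil => simpa using h
  | append_singleton ω i ih =>
    have h1 : cs.IsReduced ω := by simpa using hω.take ω.length
    have h2 := hω.eq
    have h3 := h1.eq
    rw [cs.wordProd_append, cs.wordProd_singleton, List.length_append,
      List.length_singleton] at h2
    have e : T cs q (cs.wordProd (ω ++ [i])) = opR cs q i (T cs q (cs.wordProd ω)) := by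
      rw [opR_T, cs.wordProd_append, cs.wordProd_singleton, if_pos (by omega)]
    rw [e, hf, hg, ih h1]

theorem lmul_T_simple (i : B) : lmul cs q (T cs q (cs.simple i)) = opL cs q i := by
  refine eq_of_commute cs q (fun j y => lmul_opR cs q _ y j) (fun j y => opL_opR cs q i j y) ?_
  rw [lmul_T_one, opL_T]
  simp

theorem lmul_one : lmul cs q (T cs q 1) = LinearMap.id :=
  eq_of_commute cs q (fun j y => lmul_opR cs q _ y j) (fun _ _ => rfl) (lmul_T_one cs q _)

theorem lmul_lmul (x y : HeckeAlgebra cs q) :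
    lmul cs q (lmul cs q x y) = lmul cs q x ∘ₗ lmul cs q y := by
  refine eq_of_commute cs q (fun j z => lmul_opR cs q _ z j) (fun j z => ?_) ?_
  · rw [LinearMap.comp_apply, LinearMap.comp_apply, lmul_opR, lmul_opR]
  · rw [lmul_T_one, LinearMap.comp_apply, lmul_T_one]

noncomputable instance : Ring (HeckeAlgebra cs q) where
  mul x y := lmul cs q x y
  one := T cs q 1
  mul_assoc x y z := LinearMap.congr_fun (lmul_lmul cs q x y) z
  one_mul x := LinearMap.congr_fun (lmul_one cs q) x
  mul_one x := lmul_T_one cs q x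
  left_distrib x y z := map_add (lmul cs q x) y z
  right_distrib x y z := LinearMap.congr_fun (map_add (lmul cs q) x y) z
  zero_mul x := LinearMap.congr_fun (map_zero (lmul cs q)) x
  mul_zero x := map_zero (lmul cs q x)
  neg_add_cancel x := neg_add_cancel x
  sub_eq_add_neg x y := sub_eq_add_neg x y
  zsmul := fun n x => n • x
  zsmul_zero' x := SubNegMonoid.zsmul_zero' x
  zsmul_succ' n x := SubNegMonoid.zsmul_succ' n x
  zsmul_neg' n x := SubNegMonoid.zsmul_neg' n x
  nsmul := fun n x => n • x
  nsmul_zero x := AddMonoid.nsmul_zero x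
  nsmul_succ n x := AddMonoid.nsmul_succ n x

theorem mul_def (x y : HeckeAlgebra cs q) : x * y = lmul cs q x y := rfl

theorem one_def : (1 : HeckeAlgebra cs q) = T cs q 1 := rfl

noncomputable instance : Algebra R (HeckeAlgebra cs q) :=
  Algebra.ofModule
    (fun r x y => LinearMap.congr_fun (map_smul (lmul cs q) r x) y)
    (fun r x y => map_smul (lmul cs q x) r y)

/-- The defining multiplication rule. -/
theorem T_simple_mul_T (i : B) (w : W) : T cs q (cs.simple i) * T cs q w =
    if cs.length w < cs.length (cs.simple i * w) then T cs q (cs.simple i * w)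
    else (q - 1) • T cs q w + q • T cs q (cs.simple i * w) := by
  rw [mul_def, lmul_T_simple, opL_T]

end HeckeAlgebra

/-- The Poincaré polynomial of a finite Coxeter group, evaluated at `q`. -/
noncomputable def poincare {B W R : Type*} [Group W] [Fintype W] [CommRing R]
    {M : CoxeterMatrix B} (cs : CoxeterSystem M W) (q : R) : R :=
  ∑ w : W, q ^ cs.length w

/-- The trace on the Hecke algebra with `T 1 ↦ P_W(q)` and `T w ↦ 0` for `w ≠ 1`. -/
noncomputable def heckeTrace {B W R : Type*} [Group W] [Fintype W] [CommRing R]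
    {M : CoxeterMatrix B} (cs : CoxeterSystem M W) (q : R) : HeckeAlgebra cs q →ₗ[R] R :=
  poincare cs q • (HeckeAlgebra.basisT cs q).coord 1

/-- The normalized basis elements `q ^ (-ℓ(w)) T w`. -/
noncomputable def normT {B W F : Type*} [Group W] [Field F]
    {M : CoxeterMatrix B} (cs : CoxeterSystem M W) (q : F) (w : W) : HeckeAlgebra cs q :=
  (q ^ cs.length w)⁻¹ • HeckeAlgebra.T cs q w

/-- The matrix of left multiplication by `h` with respect to the normalized basis, in the
convention of Markov chains: `h * normT x = ∑ y, K(x, y) normT y`. Hence the coefficient of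
`T y` in `h * normT x` is `K(x, y) q ^ (-ℓ(y))`. -/
noncomputable def leftMulChain {B W F : Type*} [Group W] [Field F]
    {M : CoxeterMatrix B} (cs : CoxeterSystem M W) (q : F) (h : HeckeAlgebra cs q) :
    Matrix W W F :=
  fun x y => q ^ cs.length y * (HeckeAlgebra.basisT cs q).repr (h * normT cs q x) y

theorem mul_normT_eq_sum {B W F : Type*} [Group W] [Fintype W] [Field F]
    {M : CoxeterMatrix B} (cs : CoxeterSystem M W) (q : F) (hq : q ≠ 0) (h : HeckeAlgebra cs q)
    (x : W) : h * normT cs q x = ∑ y, leftMulChain cs q h x y • normT cs q y := by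
  have e : ∀ y, leftMulChain cs q h x y • normT cs q y =
      (HeckeAlgebra.basisT cs q).repr (h * normT cs q x) y • HeckeAlgebra.basisT cs q y := by
    intro y
    have hq' : q ^ cs.length y ≠ 0 := pow_ne_zero _ hq
    rw [leftMulChain, show normT cs q y = (q ^ cs.length y)⁻¹ • HeckeAlgebra.T cs q y from rfl,
      smul_smul, HeckeAlgebra.T]
    congr 1
    field_simp
  rw [Finset.sum_congr rfl fun y _ => e y, (HeckeAlgebra.basisT cs q).sum_repr]

/-! ### Probability -/

/-- The distribution `π(w) = θ ^ (-ℓ(w)) / P_W(θ⁻¹)`. -/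
noncomputable def lengthDist {B W : Type*} [Group W] [Fintype W]
    {M : CoxeterMatrix B} (cs : CoxeterSystem M W) (θ : ℝ) (w : W) : ℝ :=
  θ⁻¹ ^ cs.length w / poincare cs θ⁻¹

/-- `K` is a Markov chain (a stochastic matrix), reversible with respect to the probability
distribution `μ`. -/
def IsReversibleChain {X : Type*} [Fintype X] (μ : X → ℝ) (K : Matrix X X ℝ) : Prop :=
  ((∀ x, 0 ≤ μ x) ∧ ∑ x, μ x = 1) ∧ ((∀ x y, 0 ≤ K x y) ∧ ∀ x, ∑ y, K x y = 1) ∧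
    ∀ x y, μ x * K x y = μ y * K y x

/-- The squared norm `∑ f(x)² μ(x)` of `L²(μ)`. -/
noncomputable def l2NormSq {X : Type*} [Fintype X] (μ f : X → ℝ) : ℝ :=
  ∑ x, f x ^ 2 * μ x

/-- `‖K_x^n / μ - 1‖²` in `L²(μ)`, where `K_x^n` is the law after `n` steps of the chain `K`
started at `x`. -/
noncomputable def chainDistSq {X : Type*} [Fintype X] [DecidableEq X] (μ : X → ℝ)
    (K : Matrix X X ℝ) (x : X) (n : ℕ) : ℝ :=
  l2NormSq μ fun y => (K ^ n) x y / μ y - 1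

/-! ### Irreducible characters -/

/-- `χ` is the character of a (finite-dimensional) irreducible representation of the complex
algebra `A`. -/
def IsIrrCharacter (A : Type*) [Ring A] [Algebra ℂ A] (χ : A →ₗ[ℂ] ℂ) : Prop :=
  ∃ (d : ℕ) (ρ : A →ₐ[ℂ] Module.End ℂ (Fin d → ℂ)), 0 < d ∧
    (∀ p : Submodule ℂ (Fin d → ℂ), (∀ a, ∀ v ∈ p, ρ a v ∈ p) → p = ⊥ ∨ p = ⊤) ∧
    ∀ a, χ a = LinearMap.trace ℂ (Fin d → ℂ) (ρ a)

/-- The irreducible characters of a complex algebra. -/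
def IrrChar (A : Type*) [Ring A] [Algebra ℂ A] : Type _ :=
  {χ : A →ₗ[ℂ] ℂ // IsIrrCharacter A χ}

noncomputable instance (A : Type*) [Ring A] [Algebra ℂ A] : DecidableEq (IrrChar A) :=
  Classical.decEq _

/-- The index set `Ŵ`: the irreducible complex characters of the group `W`, as linear functionals
on the group algebra. -/
abbrev GroupIrr (W : Type*) [Group W] : Type _ := IrrChar (MonoidAlgebra ℂ W)

/-- The value `χ(w)` of an irreducible character. -/
noncomputable def GroupIrr.val {W : Type*} [Group W] (χ : GroupIrr W) (w : W) : ℂ :=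
  χ.1 (MonoidAlgebra.of ℂ W w)

/-- The trivial character `1`. -/
noncomputable def GroupIrr.trivial (W : Type*) [Group W] : GroupIrr W :=
  ⟨(MonoidAlgebra.lift ℂ ℂ W (1 : W →* ℂ)).toLinearMap,
    1, (Algebra.ofId ℂ (Module.End ℂ (Fin 1 → ℂ))).comp (MonoidAlgebra.lift ℂ ℂ W (1 : W →* ℂ)),
    one_pos, by
      intro p _
      have h : IsSimpleOrder (Submodule ℂ (Fin 1 → ℂ)) := by
        have : IsSimpleModule ℂ (Fin 1 → ℂ) :=
          isSimpleModule_iff_finrank_eq_one.2 (by simp)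
        exact (isSimpleModule_iff ℂ _).1 this
      exact h.eq_bot_or_eq_top p, by
      intro a
      simp [Algebra.ofId_apply, Algebra.algebraMap_eq_smul_one]⟩

theorem GroupIrr.trivial_val {W : Type*} [Group W] (w : W) :
    (GroupIrr.trivial W).val w = 1 := by
  simp [GroupIrr.trivial, GroupIrr.val]

open Classical in
theorem GroupIrr.orthonormal {W : Type*} [Group W] [Fintype W] (χ ψ : GroupIrr W) :
    (Nat.card W : ℂ)⁻¹ * ∑ g : W, χ.val g * ψ.val g⁻¹ = if χ = ψ then 1 else 0 := by
  have key : ∀ χ : GroupIrr W, ∃ (d : ℕ) (σ : Representation ℂ W (Fin d → ℂ)),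
      σ.IsIrreducible ∧ ∀ g, χ.val g = σ.character g := by
    rintro ⟨χ, d, ρ, hd, hρ, hχ⟩
    refine ⟨d, ρ.toMonoidHom.comp (MonoidAlgebra.of ℂ W), ?_, fun g => hχ _⟩
    have hne : Nontrivial (Fin d → ℂ) := by
      have : Nonempty (Fin d) := ⟨⟨0, hd⟩⟩
      infer_instance
    refine { exists_pair_ne := ⟨⊥, ⊤, fun h => ?_⟩, eq_bot_or_eq_top := fun p => ?_ }
    · exact bot_ne_top (α := Submodule ℂ (Fin d → ℂ))
        (congrArg Subrepresentation.toSubmodule h)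
    · have hinv : ∀ a, ∀ v ∈ p.toSubmodule, ρ a v ∈ p.toSubmodule := by
        intro a v hv
        induction a using MonoidAlgebra.induction_on with
        | of g => exact p.apply_mem_toSubmodule g hv
        | add f g hf hg =>
          rw [map_add]
          exact p.toSubmodule.add_mem hf hg
        | smul r f hf =>
          rw [map_smul]
          exact p.toSubmodule.smul_mem r hf
      rcases hρ p.toSubmodule hinv with h | h
      · exact Or.inl (Subrepresentation.toSubmodule_injective h)
      · exact Or.inr (Subrepresentation.toSubmodule_injective h)
  obtain ⟨d, σ, hσ, hχ⟩ := key χ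
  obtain ⟨e, τ, hτ, hψ⟩ := key ψ
  have : Invertible (Nat.card W : ℂ) :=
    invertibleOfNonzero (Nat.cast_ne_zero.2 Nat.card_pos.ne')
  simp only [hχ, hψ]
  by_cases h : χ = ψ
  · have hc : σ.character = τ.character := by
      funext g; rw [← hχ, ← hψ, h]
    rw [← hc, Representation.char_orthonormal σ σ,
      if_pos ⟨Representation.Equiv.refl σ⟩, if_pos h]
  · rw [Representation.char_orthonormal σ τ, if_neg h, if_neg]
    rintro ⟨f⟩
    refine h (Subtype.ext ?_)
    refine MonoidAlgebra.lhom_ext' fun g => LinearMap.ext_ring ?_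
    have hg : χ.val g = ψ.val g := by
      rw [hχ, hψ, Representation.char_iso f]
    simpa [GroupIrr.val] using hg

/-- A finite group has finitely many irreducible characters. -/
instance GroupIrr.instFinite {W : Type*} [Group W] [Finite W] : Finite (GroupIrr W) := by
  classical
  have := Fintype.ofFinite W
  have hli : LinearIndependent ℂ (fun χ : GroupIrr W => χ.val) := by
    rw [linearIndependent_iff']
    intro s c hc ψ hψ
    have h1 : ∀ g, ∑ χ ∈ s, c χ * χ.val g = 0 := by
      intro g
      have := congrFun hc g
      simpa [Finset.sum_apply] using this
    have h2 : ∑ χ ∈ s, c χ * ((Nat.card W : ℂ)⁻¹ * ∑ g : W, χ.val g * ψ.val g⁻¹) = 0 := by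
      have : ∑ χ ∈ s, c χ * ((Nat.card W : ℂ)⁻¹ * ∑ g : W, χ.val g * ψ.val g⁻¹) =
          (Nat.card W : ℂ)⁻¹ * ∑ g : W, (∑ χ ∈ s, c χ * χ.val g) * ψ.val g⁻¹ := by
        simp only [Finset.mul_sum, Finset.sum_mul]
        rw [Finset.sum_comm]
        refine Finset.sum_congr rfl fun g _ => Finset.sum_congr rfl fun χ _ => ?_
        ring
      rw [this]
      simp [h1]
    simp only [GroupIrr.orthonormal] at h2
    simpa [hψ] using h2
  exact hli.finite_of_isNoetherian

noncomputable instance GroupIrr.instFintype {W : Type*} [Group W] [Finite W] :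
    Fintype (GroupIrr W) :=
  Fintype.ofFinite _

/-- The dimension `d_χ = χ(1)`. -/
noncomputable def GroupIrr.dim {W : Type*} [Group W] (χ : GroupIrr W) : ℂ := χ.val 1

open Classical in
/-- The sum of all reflections, in the group algebra. -/
noncomputable def reflectionSum {B W : Type*} [Group W] [Fintype W] {M : CoxeterMatrix B}
    (cs : CoxeterSystem M W) : MonoidAlgebra ℂ W :=
  ∑ t : W with cs.IsReflection t, MonoidAlgebra.of ℂ W t

/-- The constant `c_χ = χ(z) / d_χ`, where `z` is the sum of all reflections. -/
noncomputable def GroupIrr.content {B W : Type*} [Group W] [Fintype W] {M : CoxeterMatrix B}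
    (cs : CoxeterSystem M W) (χ : GroupIrr W) : ℂ :=
  χ.1 (reflectionSum cs) / χ.dim

/-! ### The correspondence of irreducible characters and the generic degrees -/

/-- A family of correspondences `χ ↦ χ_q`, one for each real `q ≥ 1`, between the irreducible
characters of `W` and of the Hecke algebra with parameter `q`. -/
abbrev HeckeCorrespondence {B W : Type*} [Group W] {M : CoxeterMatrix B}
    (cs : CoxeterSystem M W) : Type _ :=
  (q : Set.Ici (1 : ℝ)) → (GroupIrr W ≃ IrrChar (HeckeAlgebra cs ((q : ℝ) : ℂ)))

/-- The correspondence given by specialization: the values `χ_q(T w)` are continuous functions of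
the parameter `q`, and specialize at `q = 1` to the values `χ(w)`. -/
def HeckeCorrespondence.IsSpecialization {B W : Type*} [Group W] {M : CoxeterMatrix B}
    {cs : CoxeterSystem M W} (X : HeckeCorrespondence cs) : Prop :=
  ∀ (χ : GroupIrr W) (w : W),
    Continuous (fun q : Set.Ici (1 : ℝ) => (X q χ).1 (HeckeAlgebra.T cs ((q : ℝ) : ℂ) w)) ∧
    (X ⟨1, Set.self_mem_Ici⟩ χ).1 (HeckeAlgebra.T cs (((1 : ℝ)) : ℂ) w) = χ.val w

/-- The numbers `t χ` are the generic degrees at the parameter `q`: the coefficients of the trace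
`T 1 ↦ P_W(q)`, `T w ↦ 0` (`w ≠ 1`) in terms of the irreducible characters. -/
def HeckeCorrespondence.IsGenericDegree {B W : Type*} [Group W] [Fintype W] {M : CoxeterMatrix B}
    {cs : CoxeterSystem M W} (X : HeckeCorrespondence cs) (q : Set.Ici (1 : ℝ))
    (t : GroupIrr W → ℂ) : Prop :=
  heckeTrace cs ((q : ℝ) : ℂ) = ∑ χ : GroupIrr W, t χ • (X q χ).1

/-! The matrix `K` is left multiplication by the element `h = normT w₀ ^ 2`, which is central and
fixed by the anti-involution `T w ↦ T w⁻¹`. The second fact makes `K` reversible, so the squared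
`L²` distance from `x` is the return probability `K^(2n)(x,x) / π(x) - 1`
(`IsReversibleChain.chainDistSq_eq`). At `x = 1`, since `1/π(1) = P_W(q)`, this is `heckeTrace
(h^(2n)) - 1`. Averaged over `π` it is the trace of left multiplication by `h^(2n)`, minus `1`.
Expanding the first trace by generic degrees and the second by the regular character reduces both
formulas to the scalar by which `h` acts on each irreducible representation. The trivial character
contributes exactly `1` because it corresponds to the index representation and has generic degree
`1`.

To compare irreducible characters at different parameters, the real Hecke algebras with `q ≥ 1` are
identified with the one at `q = 1`, continuously in `q` (`exists_real_trivialization`). The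
`q`-derivative of the product is a Hochschild 2-cocycle. The element `∑ q^(-ℓ w) T w ⊗ T w⁻¹`, whose
product is a Casimir element invertible by positivity, makes it the coboundary of a continuous
operator `D q` (`coboundary_of_separability`). The solution of `G' = D G`, `G 1 = 1`, then carries
the product at `1` to the product at `q`. Orthonormality of group characters gives uniqueness of the
correspondence: the pairing of a continuous family with a fixed character takes only the values `0`
and `1`, hence is constant.

The scalar `c q` of `T w₀ ^ 2` (`correspondence_T_longest`) is found from determinants. On a
representation of dimension `d`, each `T s` has eigenvalues `q` and `-1`, with multiplicities that
are continuous in `q` and therefore constant; at `q = 1` they are read off from `χ(s)`. Multiplying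
along a reduced word of `w₀`, whose inversion sequence lists every reflection once, gives `c q ^ d =
q^(d (ℓ(w₀) + c_χ))`. So `c q` is `q^(ℓ(w₀) + c_χ)` up to a continuous root of unity that is `1` at
`q = 1`. Normalizing by `q^(-2 ℓ(w₀))` leaves `θ^(ℓ(w₀) - c_χ)`. -/

/-! ### Symmetrizing trace, anti-involution, index representation, change of scalars -/

namespace HeckeAlgebra

variable {B W R : Type*} [Group W] [CommRing R] {M : CoxeterMatrix B}
  (cs : CoxeterSystem M W) (q : R)

theorem mul_T_simple (x : HeckeAlgebra cs q) (i : B) :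
    x * T cs q (cs.simple i) = opR cs q i x := by
  have h : T cs q (cs.simple i) = opR cs q i (T cs q 1) := by
    rw [opR_T]; simp
  rw [mul_def, h, lmul_opR, lmul_T_one]

theorem T_mul_T_simple (w : W) (i : B) : T cs q w * T cs q (cs.simple i) =
    if cs.length w < cs.length (w * cs.simple i) then T cs q (w * cs.simple i)
    else (q - 1) • T cs q w + q • T cs q (w * cs.simple i) := by
  rw [mul_T_simple, opR_T]

theorem T_simple_mul_of_lt {i : B} {w : W} (h : cs.length w < cs.length (cs.simple i * w)) :
    T cs q (cs.simple i) * T cs q w = T cs q (cs.simple i * w) := by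
  rw [T_simple_mul_T, if_pos h]

theorem T_mul_simple_of_lt {i : B} {w : W} (h : cs.length w < cs.length (w * cs.simple i)) :
    T cs q w * T cs q (cs.simple i) = T cs q (w * cs.simple i) := by
  rw [T_mul_T_simple, if_pos h]

theorem quadratic_relation (i : B) :
    (T cs q (cs.simple i) - q • 1) * (T cs q (cs.simple i) + 1) = 0 := by
  have h := T_simple_mul_T cs q i (cs.simple i)
  rw [cs.simple_mul_simple_self, cs.length_one, if_neg (by omega), ← one_def] at h
  rw [sub_mul, mul_add, mul_add, h]
  simp only [mul_one, smul_mul_assoc, one_mul, sub_smul, one_smul]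
  abel

/-- Every property of the basis elements may be proved by multiplying from the left by simple
reflections. -/
theorem length_induction_left {p : W → Prop} (one : p 1)
    (mul : ∀ i w, cs.length w < cs.length (cs.simple i * w) → p w → p (cs.simple i * w)) (w : W) :
    p w := by
  induction h : cs.length w generalizing w with
  | zero => rw [cs.length_eq_zero_iff] at h; exact h ▸ one
  | succ n ih =>
    obtain ⟨i, hi⟩ := cs.exists_leftDescent_of_ne_one (w := w) (by rintro rfl; simp at h)
    rw [cs.isLeftDescent_iff] at hi
    have := mul i (cs.simple i * w) (by simp; omega) (ih _ (by omega))
    simpa using this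

theorem length_induction_right {p : W → Prop} (one : p 1)
    (mul : ∀ w i, cs.length w < cs.length (w * cs.simple i) → p w → p (w * cs.simple i)) (w : W) :
    p w := by
  have := length_induction_left cs (p := fun w => p w⁻¹) (by simpa using one) (fun i w h hp => by
    have := mul w⁻¹ i (by
      rw [← cs.length_inv (w⁻¹ * _), cs.length_inv w]; simpa using h) hp
    simpa using this) w⁻¹
  simpa using this

/-- The coefficient of `T 1`, a symmetrizing trace. -/
noncomputable def tau : HeckeAlgebra cs q →ₗ[R] R := (basisT cs q).coord 1

theorem repr_T [DecidableEq W] (w y : W) :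
    (basisT cs q).repr (T cs q w) y = if w = y then 1 else 0 := by
  rw [T, Module.Basis.repr_self, Finsupp.single_apply]

theorem tau_T [DecidableEq W] (w : W) : tau cs q (T cs q w) = if w = 1 then 1 else 0 := by
  rw [tau, Module.Basis.coord_apply, repr_T]

/-- This says that `T w` and `q^(-ℓ w) T w⁻¹` are dual bases for `tau` when `q` is invertible. The
induction moves the last letter of `x` over to `y`; the unwanted terms of the quadratic rule drop
out because `x * z = 1` forces `ℓ(z) = ℓ(x)`. -/
theorem tau_T_mul_T [DecidableEq W] (x y : W) :
    tau cs q (T cs q x * T cs q y) = if x * y = 1 then q ^ cs.length x else 0 := by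
  induction x using length_induction_right cs generalizing y with
  | one => simp [← one_def, tau_T]
  | mul x i hx ih =>
    have lx : cs.length (x * cs.simple i) = cs.length x + 1 := by
      rcases cs.length_mul_simple x i with h | h <;> omega
    have aux : ∀ z, x * z = 1 → cs.length z = cs.length x := by
      intro z hz
      rw [eq_inv_of_mul_eq_one_right hz, cs.length_inv]
    have aux' : ∀ z, x * cs.simple i * z = 1 → cs.length z = cs.length x + 1 := by
      intro z hz
      rw [eq_inv_of_mul_eq_one_right hz, cs.length_inv, lx]
    rw [← T_mul_simple_of_lt cs q hx, mul_assoc, T_simple_mul_T]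
    split_ifs with h1 h2 h2
    · have e1 := aux' _ h2
      rw [mul_assoc] at h2
      have := aux _ h2
      omega
    · rw [ih, if_neg]
      rwa [← mul_assoc]
    · have h3 : ¬ x * y = 1 := by
        intro h
        have := aux _ h
        have := aux' _ h2
        omega
      rw [mul_assoc] at h2
      rw [mul_add, map_add, mul_smul_comm, mul_smul_comm, map_smul, map_smul, ih, ih, if_neg h3,
        if_pos h2, lx]
      simp [pow_succ']
    · have h3 : ¬ x * y = 1 := by
        intro h
        have e1 := aux _ h
        rw [eq_inv_of_mul_eq_one_right h] at h1
        apply h1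
        rw [← cs.length_inv (cs.simple i * x⁻¹), cs.length_inv x]
        simpa using hx
      rw [mul_assoc] at h2
      rw [mul_add, map_add, mul_smul_comm, mul_smul_comm, map_smul, map_smul, ih, ih, if_neg h3,
        if_neg h2]
      simp

/-- A linear map is determined by its values on the `T w`. -/
theorem linearMap_ext {N : Type*} [AddCommMonoid N] [Module R N]
    {f g : HeckeAlgebra cs q →ₗ[R] N} (h : ∀ w, f (T cs q w) = g (T cs q w)) : f = g :=
  (basisT cs q).ext h

theorem tau_mul_comm (a b : HeckeAlgebra cs q) : tau cs q (a * b) = tau cs q (b * a) := by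
  classical
  suffices h : (LinearMap.mul R (HeckeAlgebra cs q)).compr₂ (tau cs q) =
      (LinearMap.mul R (HeckeAlgebra cs q)).flip.compr₂ (tau cs q) from
    LinearMap.congr_fun₂ h a b
  refine linearMap_ext cs q fun x => linearMap_ext cs q fun y => ?_
  simp only [LinearMap.compr₂_apply, LinearMap.mul_apply', LinearMap.flip_apply, tau_T_mul_T]
  by_cases h : x * y = 1
  · rw [if_pos h, if_pos (mul_eq_one_comm.1 h), eq_inv_of_mul_eq_one_left h, cs.length_inv]
  · rw [if_neg h, if_neg (mt mul_eq_one_comm.1 h)]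

/-- The anti-involution `T w ↦ T w⁻¹`. -/
noncomputable def flip : HeckeAlgebra cs q →ₗ[R] HeckeAlgebra cs q :=
  (basisT cs q).constr R fun w => T cs q w⁻¹

theorem flip_T (w : W) : flip cs q (T cs q w) = T cs q w⁻¹ := by
  rw [flip, T, Module.Basis.constr_basis]

/-- The left and right multiplication rules are mirror images under inversion, which preserves
length. -/
theorem flip_T_simple_mul (i : B) (x : HeckeAlgebra cs q) :
    flip cs q (T cs q (cs.simple i) * x) = flip cs q x * T cs q (cs.simple i) := by
  suffices h : flip cs q ∘ₗ LinearMap.mulLeft R (T cs q (cs.simple i)) =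
      LinearMap.mulRight R (T cs q (cs.simple i)) ∘ₗ flip cs q from LinearMap.congr_fun h x
  refine linearMap_ext cs q fun w => ?_
  have e : cs.length (w⁻¹ * cs.simple i) = cs.length (cs.simple i * w) := by
    rw [← cs.length_inv]; simp
  simp only [LinearMap.comp_apply, LinearMap.mulLeft_apply, LinearMap.mulRight_apply, flip_T]
  rw [T_simple_mul_T, T_mul_T_simple, cs.length_inv, e]
  split_ifs <;> simp [flip_T]

theorem flip_mul (a b : HeckeAlgebra cs q) :
    flip cs q (a * b) = flip cs q b * flip cs q a := by
  suffices h : (LinearMap.mul R (HeckeAlgebra cs q)).compr₂ (flip cs q) =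
      (LinearMap.mul R (HeckeAlgebra cs q)).flip.compl₁₂ (flip cs q) (flip cs q) from
    LinearMap.congr_fun₂ h a b
  refine linearMap_ext cs q fun x => LinearMap.ext fun y => ?_
  simp only [LinearMap.compr₂_apply, LinearMap.mul_apply', LinearMap.flip_apply,
    LinearMap.compl₁₂_apply]
  induction x using length_induction_left cs generalizing y with
  | one =>
    rw [flip_T, inv_one, ← one_def, one_mul, mul_one]
  | mul i w hw ih =>
    rw [← T_simple_mul_of_lt cs q hw, mul_assoc, flip_T_simple_mul, ih, flip_T_simple_mul,
      mul_assoc]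

theorem tau_flip (a : HeckeAlgebra cs q) : tau cs q (flip cs q a) = tau cs q a := by
  classical
  suffices h : tau cs q ∘ₗ flip cs q = tau cs q from LinearMap.congr_fun h a
  refine linearMap_ext cs q fun w => ?_
  simp [flip_T, tau_T]

/-- The index representation `T w ↦ q ^ ℓ(w)`, as a linear functional. -/
noncomputable def indexFun : HeckeAlgebra cs q →ₗ[R] R :=
  (basisT cs q).constr R fun w => q ^ cs.length w

theorem indexFun_T (w : W) : indexFun cs q (T cs q w) = q ^ cs.length w := by
  rw [indexFun, T, Module.Basis.constr_basis]

theorem indexFun_T_simple_mul (i : B) (x : HeckeAlgebra cs q) :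
    indexFun cs q (T cs q (cs.simple i) * x) = q * indexFun cs q x := by
  suffices h : indexFun cs q ∘ₗ LinearMap.mulLeft R (T cs q (cs.simple i)) =
      q • indexFun cs q from LinearMap.congr_fun h x
  refine linearMap_ext cs q fun w => ?_
  simp only [LinearMap.comp_apply, LinearMap.mulLeft_apply, LinearMap.smul_apply, indexFun_T]
  rw [T_simple_mul_T]
  have := cs.length_simple_mul w i
  split_ifs with h
  · rw [indexFun_T, show cs.length (cs.simple i * w) = cs.length w + 1 by omega, pow_succ',
      smul_eq_mul]
  · rw [map_add, map_smul, map_smul, indexFun_T, indexFun_T,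
      show cs.length w = cs.length (cs.simple i * w) + 1 by omega, pow_succ', smul_eq_mul,
      smul_eq_mul, smul_eq_mul]
    ring

theorem indexFun_mul (a b : HeckeAlgebra cs q) :
    indexFun cs q (a * b) = indexFun cs q a * indexFun cs q b := by
  suffices h : (LinearMap.mul R (HeckeAlgebra cs q)).compr₂ (indexFun cs q) =
      (LinearMap.mul R R).compl₁₂ (indexFun cs q) (indexFun cs q) from
    LinearMap.congr_fun₂ h a b
  refine linearMap_ext cs q fun x => LinearMap.ext fun y => ?_
  simp only [LinearMap.compr₂_apply, LinearMap.mul_apply', LinearMap.compl₁₂_apply]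
  induction x using length_induction_left cs generalizing y with
  | one => rw [indexFun_T, cs.length_one, pow_zero, ← one_def, one_mul, one_mul]
  | mul i w hw ih =>
    rw [← T_simple_mul_of_lt cs q hw, mul_assoc, indexFun_T_simple_mul, ih,
      indexFun_T_simple_mul, mul_assoc]

/-- The index representation `T w ↦ q ^ ℓ(w)`. -/
noncomputable def index : HeckeAlgebra cs q →ₐ[R] R :=
  AlgHom.ofLinearMap (indexFun cs q) (by rw [one_def, indexFun_T]; simp) (indexFun_mul cs q)

theorem index_T (w : W) : index cs q (T cs q w) = q ^ cs.length w := indexFun_T cs q w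

/-- Change of scalars. -/
noncomputable def mapFun {S : Type*} [CommRing S] (φ : R →+* S) :
    HeckeAlgebra cs q →+ HeckeAlgebra cs (φ q) :=
  (Finsupp.mapRange.addMonoidHom (ι := W) φ.toAddMonoidHom : (W →₀ R) →+ (W →₀ S))

section Map

variable {S : Type*} [CommRing S] (φ : R →+* S)

theorem repr_mapFun (x : HeckeAlgebra cs q) (w : W) :
    (basisT cs (φ q)).repr (mapFun cs q φ x) w = φ ((basisT cs q).repr x w) := by
  rfl

theorem mapFun_smul_T (r : R) (w : W) :
    mapFun cs q φ (r • T cs q w) = φ r • T cs (φ q) w := by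
  classical
  refine (basisT cs (φ q)).repr.injective (Finsupp.ext fun y => ?_)
  rw [repr_mapFun, map_smul, map_smul, Finsupp.smul_apply, Finsupp.smul_apply, repr_T, repr_T]
  split_ifs <;> simp

theorem mapFun_T (w : W) : mapFun cs q φ (T cs q w) = T cs (φ q) w := by
  simpa using mapFun_smul_T cs q φ 1 w

theorem mapFun_smul (r : R) (x : HeckeAlgebra cs q) :
    mapFun cs q φ (r • x) = φ r • mapFun cs q φ x := by
  refine (basisT cs (φ q)).repr.injective (Finsupp.ext fun y => ?_)
  rw [repr_mapFun, map_smul, map_smul, Finsupp.smul_apply, Finsupp.smul_apply, repr_mapFun,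
    smul_eq_mul, smul_eq_mul, map_mul]

theorem induction_on {p : HeckeAlgebra cs q → Prop} (x : HeckeAlgebra cs q)
    (T : ∀ w, p (T cs q w)) (add : ∀ x y, p x → p y → p (x + y))
    (smul : ∀ (r : R) x, p x → p (r • x)) : p x := by
  have : x ∈ Submodule.span R (Set.range (basisT cs q)) := by
    rw [Module.Basis.span_eq]; trivial
  induction this using Submodule.span_induction with
  | mem x h => obtain ⟨w, rfl⟩ := h; exact T w
  | zero => simpa using smul 0 _ (T 1)
  | add x y _ _ hx hy => exact add x y hx hy
  | smul r x _ hx => exact smul r x hx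

theorem mapFun_T_simple_mul (i : B) (x : HeckeAlgebra cs q) :
    mapFun cs q φ (T cs q (cs.simple i) * x) =
      T cs (φ q) (cs.simple i) * mapFun cs q φ x := by
  induction x using induction_on with
  | T w =>
    rw [T_simple_mul_T, mapFun_T, T_simple_mul_T]
    split_ifs
    · rw [mapFun_T]
    · rw [map_add, mapFun_smul_T, mapFun_smul_T, map_sub, map_one]
  | add x y hx hy => rw [mul_add, map_add, hx, hy, map_add, mul_add]
  | smul r x hx => rw [mul_smul_comm, mapFun_smul, hx, mapFun_smul, mul_smul_comm]

theorem mapFun_mul (x y : HeckeAlgebra cs q) :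
    mapFun cs q φ (x * y) = mapFun cs q φ x * mapFun cs q φ y := by
  induction x using induction_on with
  | T w =>
    induction w using length_induction_left cs generalizing y with
    | one => rw [mapFun_T, ← one_def, ← one_def, one_mul, one_mul]
    | mul i w hw ih =>
      rw [← T_simple_mul_of_lt cs q hw, mul_assoc, mapFun_T_simple_mul, ih, mapFun_T_simple_mul,
        mul_assoc]
  | add x z hx hz => rw [add_mul, map_add, hx, hz, map_add, add_mul]
  | smul r x hx => rw [smul_mul_assoc, mapFun_smul, hx, mapFun_smul, smul_mul_assoc]

/-- Change of scalars, as a ring homomorphism. -/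
noncomputable def map : HeckeAlgebra cs q →+* HeckeAlgebra cs (φ q) :=
  { mapFun cs q φ with
    map_one' := mapFun_T cs q φ 1
    map_mul' := mapFun_mul cs q φ }

theorem map_T (w : W) : map cs q φ (T cs q w) = T cs (φ q) w := mapFun_T cs q φ w

theorem map_smul' (r : R) (x : HeckeAlgebra cs q) :
    map cs q φ (r • x) = φ r • map cs q φ x := mapFun_smul cs q φ r x

end Map

theorem T_mul_T_of_eq_one (hq : q = 1) (x y : W) : T cs q x * T cs q y = T cs q (x * y) := by
  induction x using length_induction_left cs generalizing y with
  | one => simp [← one_def]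
  | mul i w hw ih =>
    rw [← T_simple_mul_of_lt cs q hw, mul_assoc, ih, T_simple_mul_T, mul_assoc]
    simp [hq]

/-- Coefficient extraction by the dual basis; the form with `q ^ ℓ(y)` on the left avoids dividing
by `q`. -/
theorem pow_mul_repr (a : HeckeAlgebra cs q) (y : W) :
    q ^ cs.length y * (basisT cs q).repr a y = tau cs q (T cs q y⁻¹ * a) := by
  classical
  induction a using induction_on with
  | T w =>
    rw [tau_T_mul_T, repr_T, cs.length_inv]
    simp only [inv_mul_eq_one, eq_comm (a := w)]
    simp
  | add x z hx hz => rw [mul_add, map_add, map_add, ← hx, ← hz, Finsupp.add_apply, mul_add]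
  | smul r x hx =>
    rw [mul_smul_comm, map_smul, map_smul, ← hx, Finsupp.smul_apply, smul_eq_mul, smul_eq_mul]
    ring

/-- For `a = T x` only the summand `w = x⁻¹` survives, and it contributes `q ^ ℓ(x)`. -/
theorem tau_mul_sum_T [Fintype W] (a : HeckeAlgebra cs q) :
    tau cs q (a * ∑ w, T cs q w) = index cs q a := by
  classical
  induction a using induction_on with
  | T x =>
    rw [Finset.mul_sum, map_sum, index_T]
    simp only [tau_T_mul_T, mul_eq_one_iff_eq_inv']
    simp
  | add x z hx hz => rw [add_mul, map_add, hx, hz, map_add]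
  | smul r x hx => rw [smul_mul_assoc, map_smul, map_smul, hx]

/-- The sum of the basis elements spans the index representation. -/
theorem mul_sum_T [Fintype W] [IsDomain R] (hq : q ≠ 0) (a : HeckeAlgebra cs q) :
    a * ∑ w, T cs q w = index cs q a • ∑ w, T cs q w := by
  classical
  refine (basisT cs q).repr.injective (Finsupp.ext fun y => ?_)
  refine mul_left_cancel₀ (pow_ne_zero (cs.length y) hq) ?_
  rw [pow_mul_repr, pow_mul_repr, ← mul_assoc, tau_mul_sum_T, mul_smul_comm, map_smul,
    tau_mul_sum_T, map_mul, smul_eq_mul, mul_comm]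

theorem eq_sum_repr [Fintype W] (a : HeckeAlgebra cs q) :
    a = ∑ w, (basisT cs q).repr a w • T cs q w :=
  ((basisT cs q).sum_repr a).symm

end HeckeAlgebra

/-! ### Nonnegativity of the structure constants for `q ≥ 1` -/

namespace HeckeAlgebra

variable {B W : Type*} [Group W] {M : CoxeterMatrix B} (cs : CoxeterSystem M W)

theorem repr_T_simple_mul_nonneg {q : ℝ} (hq : 1 ≤ q) (i : B) {a : HeckeAlgebra cs q}
    (ha : ∀ y, 0 ≤ (basisT cs q).repr a y) (y : W) :
    0 ≤ (basisT cs q).repr (T cs q (cs.simple i) * a) y := by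
  classical
  rw [← (basisT cs q).linearCombination_repr a, Finsupp.linearCombination_apply, Finsupp.sum,
    Finset.mul_sum, map_sum, Finsupp.finsetSum_apply]
  refine Finset.sum_nonneg fun w _ => ?_
  rw [mul_smul_comm, map_smul, Finsupp.smul_apply, smul_eq_mul]
  refine mul_nonneg (ha w) ?_
  change 0 ≤ (basisT cs q).repr (T cs q (cs.simple i) * T cs q w) y
  rw [T_simple_mul_T]
  have h0 : ∀ w, 0 ≤ (basisT cs q).repr (T cs q w) y := by
    intro w; rw [repr_T]; split_ifs <;> norm_num
  split_ifs
  · exact h0 _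
  · rw [map_add, map_smul, map_smul, Finsupp.add_apply, Finsupp.smul_apply, Finsupp.smul_apply,
      smul_eq_mul, smul_eq_mul]
    have := h0 w
    have := h0 (cs.simple i * w)
    have : 0 ≤ q - 1 := by linarith
    positivity

theorem repr_T_mul_nonneg {q : ℝ} (hq : 1 ≤ q) (w : W) {a : HeckeAlgebra cs q}
    (ha : ∀ y, 0 ≤ (basisT cs q).repr a y) (y : W) :
    0 ≤ (basisT cs q).repr (T cs q w * a) y := by
  induction w using length_induction_left cs generalizing y with
  | one => simpa [← one_def] using ha y
  | mul i w hw ih =>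
    rw [← T_simple_mul_of_lt cs q hw, mul_assoc]
    exact repr_T_simple_mul_nonneg cs hq i ih y

end HeckeAlgebra

/-! ### Inversions and the longest element -/

namespace CoxeterSystem

variable {B W : Type*} [Group W] {M : CoxeterMatrix B} (cs : CoxeterSystem M W)

/-- The cocycle identity expressing that `reflAction` is a homomorphism. -/
theorem invParity_mul (u v t : W) :
    cs.invParity (u * v) t = cs.invParity v t + cs.invParity u (v * t * v⁻¹) := by
  conv_lhs => rw [invParity, map_mul, Equiv.Perm.mul_apply, reflAction_apply, reflAction_apply]
  simp

theorem invParity_one (t : W) : cs.invParity 1 t = 0 := by simp [invParity]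

/-- Write `t = u s u⁻¹` and compare the cocycle identity for `u * u⁻¹ = 1` with that for `(u s) *
u⁻¹`: inserting `s` changes the parity by one. -/
theorem invParity_self {t : W} (ht : cs.IsReflection t) : cs.invParity t t = 1 := by
  obtain ⟨u, i, rfl⟩ := ht
  have h1 := cs.invParity_mul u u⁻¹ (u * cs.simple i * u⁻¹)
  have h2 := cs.invParity_mul (u * cs.simple i) u⁻¹ (u * cs.simple i * u⁻¹)
  have e : u⁻¹ * (u * cs.simple i * u⁻¹) * u⁻¹⁻¹ = cs.simple i := by group
  rw [e, mul_inv_cancel, invParity_one] at h1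
  rw [e, invParity_mul_simple] at h2
  rw [h2, add_left_comm, ← h1, add_zero]

theorem zmod_two_ne_zero {a : ZMod 2} : a ≠ 0 ↔ a = 1 := by
  revert a; decide

theorem invParity_eq_one_iff (w : W) {t : W} (ht : cs.IsReflection t) :
    cs.invParity w t = 1 ↔ cs.length (w * t) < cs.length w := by
  refine ⟨fun h => cs.length_mul_lt_of_invParity_ne_zero w t (by rw [h]; decide), fun h => ?_⟩
  by_contra h0
  have h0' : cs.invParity w t = 0 := by
    by_contra h1; exact h0 (zmod_two_ne_zero.1 h1)
  -- If `w` has parity `0` at `t`, then `w t` has parity `1`, so multiplying `w t` by `t` shortens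
  -- it.
  have h1 := cs.invParity_mul w t t
  rw [cs.invParity_self ht, mul_inv_cancel_right, h0', add_zero] at h1
  have h2 := cs.length_mul_lt_of_invParity_ne_zero (w * t) t (by rw [h1]; decide)
  rw [mul_assoc, ht.mul_self, mul_one] at h2
  omega

theorem mem_rightInvSeq_iff {ω : List B} (hω : cs.IsReduced ω) (t : W) :
    t ∈ cs.rightInvSeq ω ↔ cs.IsReflection t ∧ cs.invParity (cs.wordProd ω) t = 1 := by
  constructor
  · intro h
    have h1 := cs.isRightInversion_of_mem_rightInvSeq hω h
    exact ⟨h1.1, (cs.invParity_eq_one_iff _ h1.1).2 h1.2⟩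
  · rintro ⟨_, h⟩
    exact cs.mem_rightInvSeq_of_invParity_ne_zero ω t (by rw [h]; decide)

theorem rightInvSeq_toFinset [Fintype W] [DecidableEq W] {ω : List B} (hω : cs.IsReduced ω)
    [DecidablePred fun t => cs.IsReflection t ∧ cs.invParity (cs.wordProd ω) t = 1] :
    (cs.rightInvSeq ω).toFinset =
      Finset.univ.filter fun t => cs.IsReflection t ∧ cs.invParity (cs.wordProd ω) t = 1 := by
  ext t
  simp [cs.mem_rightInvSeq_iff hω]

open Classical in
/-- The length is the number of inversions. -/
theorem length_eq_card [Fintype W] (w : W) :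
    cs.length w =
      (Finset.univ.filter fun t => cs.IsReflection t ∧ cs.invParity w t = 1).card := by
  obtain ⟨ω, hω, rfl⟩ := cs.exists_isReduced w
  rw [← cs.rightInvSeq_toFinset hω, List.toFinset_card_of_nodup hω.nodup_rightInvSeq,
    cs.length_rightInvSeq, hω.eq]

/-- A class function has the same sum over the letters of a word and over its inversions. -/
theorem sum_map_rightInvSeq {A : Type*} [AddCommMonoid A] (f : W → A)
    (hf : ∀ u v, f (u * v * u⁻¹) = f v) (ω : List B) :
    ((cs.rightInvSeq ω).map f).sum = (ω.map fun i => f (cs.simple i)).sum := by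
  induction ω with
  | nil => simp
  | cons i ω ih =>
    rw [rightInvSeq, List.map_cons, List.sum_cons, ih, List.map_cons, List.sum_cons]
    congr 1
    simpa using hf (cs.wordProd ω)⁻¹ (cs.simple i)

section Longest

variable {w₀ : W} (hw₀ : ∀ w, cs.length w ≤ cs.length w₀)

include hw₀

theorem invParity_longest {t : W} (ht : cs.IsReflection t) : cs.invParity w₀ t = 1 := by
  rw [cs.invParity_eq_one_iff _ ht]
  exact lt_of_le_of_ne (hw₀ _) (ht.length_mul_left_ne w₀)

theorem length_longest_mul [Fintype W] (w : W) :
    cs.length (w₀ * w) + cs.length w = cs.length w₀ := by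
  classical
  rw [cs.length_eq_card (w₀ * w), cs.length_eq_card w, cs.length_eq_card w₀,
    ← Finset.card_union_of_disjoint]
  · congr 1
    ext t
    simp only [Finset.mem_union, Finset.mem_filter, Finset.mem_univ, true_and]
    by_cases ht : cs.IsReflection t
    -- Every reflection is an inversion of `w₀`, so the cocycle identity makes the inversions of `w₀
    -- w` the complement of those of `w`.
    · rw [cs.invParity_mul, cs.invParity_longest hw₀ ht, cs.invParity_longest hw₀ (ht.conj w)]
      simp only [ht, true_and]
      generalize cs.invParity w t = a
      revert a; decide
    · simp [ht]
  · rw [Finset.disjoint_left]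
    intro t
    simp only [Finset.mem_filter, Finset.mem_univ, true_and]
    rintro ⟨ht, h1⟩ ⟨_, h2⟩
    rw [cs.invParity_mul, cs.invParity_longest hw₀ (ht.conj w), h2] at h1
    revert h1; decide

theorem longest_mul_self [Fintype W] : w₀ * w₀ = 1 := by
  have := cs.length_longest_mul hw₀ w₀
  rw [← cs.length_eq_zero_iff]
  omega

theorem longest_inv [Fintype W] : w₀⁻¹ = w₀ :=
  inv_eq_of_mul_eq_one_left (cs.longest_mul_self hw₀)

theorem length_mul_longest [Fintype W] (w : W) :
    cs.length (w * w₀) + cs.length w = cs.length w₀ := by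
  have := cs.length_longest_mul hw₀ w⁻¹
  rw [← cs.length_inv (w * w₀), mul_inv_rev, cs.longest_inv hw₀, ← cs.length_inv w]
  exact this

/-- Conjugation by `w₀` preserves length, by two applications of the complement formula, so it
permutes the simple reflections. -/
theorem exists_longest_mul_simple [Fintype W] (i : B) :
    ∃ j, w₀ * cs.simple i = cs.simple j * w₀ := by
  have h1 := cs.length_mul_longest hw₀ (w₀ * cs.simple i)
  have h2 := cs.length_longest_mul hw₀ (cs.simple i)
  rw [cs.length_simple] at h2
  obtain ⟨j, hj⟩ := cs.length_eq_one_iff.1 (show cs.length (w₀ * cs.simple i * w₀) = 1 by omega)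
  refine ⟨j, ?_⟩
  rw [← hj, mul_assoc, cs.longest_mul_self hw₀, mul_one]

-- The inversion sequence of a reduced word of `w₀` contains each reflection exactly once, and each
-- entry is conjugate to the corresponding letter. This turns the product over a reduced word into
-- the reflection sum in the content.
open Classical in
theorem sum_simple_eq_sum_reflection [Fintype W] {A : Type*} [AddCommMonoid A] (f : W → A)
    (hf : ∀ u v, f (u * v * u⁻¹) = f v) {ω : List B} (hω : cs.IsReduced ω)
    (h : w₀ = cs.wordProd ω) :
    (ω.map fun i => f (cs.simple i)).sum = ∑ t : W with cs.IsReflection t, f t := by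
  rw [← cs.sum_map_rightInvSeq f hf, ← List.sum_toFinset f hω.nodup_rightInvSeq,
    cs.rightInvSeq_toFinset hω, ← h]
  refine Finset.sum_congr (Finset.filter_congr fun t _ => ?_) fun _ _ => rfl
  exact ⟨fun h => h.1, fun h => ⟨h, cs.invParity_longest hw₀ h⟩⟩

end Longest

end CoxeterSystem

/-! ### Centrality of `T w₀ ^ 2` -/

namespace HeckeAlgebra

variable {B W R : Type*} [Group W] [CommRing R] {M : CoxeterMatrix B}
  (cs : CoxeterSystem M W) (q : R)

/-- With `v = w₀ s_i = s_j w₀`, the element `T w₀` factors both as `T s_j * T v` and as `T v * T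
s_i`; both sides equal `T s_j * T v * T s_i`. -/
theorem T_longest_mul_simple [Fintype W] {w₀ : W} (hw₀ : ∀ w, cs.length w ≤ cs.length w₀) {i j : B}
    (h : w₀ * cs.simple i = cs.simple j * w₀) :
    T cs q w₀ * T cs q (cs.simple i) = T cs q (cs.simple j) * T cs q w₀ := by
  have h1 := cs.length_longest_mul hw₀ (cs.simple i)
  rw [cs.length_simple] at h1
  have e1 : T cs q (w₀ * cs.simple i) * T cs q (cs.simple i) = T cs q w₀ := by
    rw [T_mul_simple_of_lt cs q (by simp; omega)]
    simp
  have e2 : T cs q (cs.simple j) * T cs q (w₀ * cs.simple i) = T cs q w₀ := by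
    rw [T_simple_mul_of_lt cs q (by rw [h]; simp; rw [← h]; omega), h]
    simp
  rw [← e2, mul_assoc, e1, e2]

theorem commute_of_T_simple {z : HeckeAlgebra cs q}
    (h : ∀ i, T cs q (cs.simple i) * z = z * T cs q (cs.simple i)) (a : HeckeAlgebra cs q) :
    a * z = z * a := by
  induction a using induction_on with
  | T w =>
    induction w using length_induction_left cs with
    | one => rw [← one_def, one_mul, mul_one]
    | mul i w hw ih =>
      rw [← T_simple_mul_of_lt cs q hw, mul_assoc, ih, ← mul_assoc, h, mul_assoc]
  | add x y hx hy => rw [add_mul, hx, hy, mul_add]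
  | smul r x hx => rw [smul_mul_assoc, hx, mul_smul_comm]

/-- The square of `T w₀` is central. -/
theorem T_longest_sq_central [Fintype W] {w₀ : W} (hw₀ : ∀ w, cs.length w ≤ cs.length w₀)
    (a : HeckeAlgebra cs q) : a * T cs q w₀ ^ 2 = T cs q w₀ ^ 2 * a := by
  refine commute_of_T_simple cs q (fun i => ?_) a
  obtain ⟨j, hj⟩ := cs.exists_longest_mul_simple hw₀ i
  have hj' : w₀ * cs.simple j = cs.simple i * w₀ := by
    have h := cs.longest_mul_self hw₀
    calc w₀ * cs.simple j = w₀ * (cs.simple j * w₀) * w₀ := by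
          rw [mul_assoc, mul_assoc, h, mul_one]
      _ = (w₀ * w₀) * (cs.simple i * w₀) := by rw [← hj]; simp only [mul_assoc]
      _ = _ := by rw [h, one_mul]
  rw [pow_two, mul_assoc, T_longest_mul_simple cs q hw₀ hj, ← mul_assoc, ← mul_assoc,
    T_longest_mul_simple cs q hw₀ hj']

theorem prod_map_T_simple {ω : List B} (hω : cs.IsReduced ω) :
    (ω.map fun i => T cs q (cs.simple i)).prod = T cs q (cs.wordProd ω) := by
  induction ω with
  | nil => rfl
  | cons i ω ih =>
    have h1 : cs.IsReduced ω := by simpa using hω.drop 1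
    have h2 := hω.eq
    have h3 := h1.eq
    rw [cs.wordProd_cons, List.length_cons] at h2
    rw [List.map_cons, List.prod_cons, ih h1, T_simple_mul_of_lt cs q (by omega),
      cs.wordProd_cons]

end HeckeAlgebra

/-! ### Left multiplication as a reversible Markov matrix -/

namespace HeckeAlgebra

section Field

variable {B W F : Type*} [Group W] [Field F] {M : CoxeterMatrix B}
  (cs : CoxeterSystem M W) (q : F)

/-- The order is reversed because rows index the input, as for Markov chains; for powers of a single
element this is harmless. -/
theorem leftMulChain_mul [Fintype W] (hq : q ≠ 0) (a b : HeckeAlgebra cs q) :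
    leftMulChain cs q (a * b) = leftMulChain cs q b * leftMulChain cs q a := by
  ext x y
  rw [Matrix.mul_apply, leftMulChain, mul_assoc, mul_normT_eq_sum cs q hq b x, Finset.mul_sum,
    map_sum, Finsupp.finsetSum_apply, Finset.mul_sum]
  refine Finset.sum_congr rfl fun z _ => ?_
  rw [mul_smul_comm, map_smul, Finsupp.smul_apply, smul_eq_mul, leftMulChain]
  simp only [leftMulChain]
  ring

theorem leftMulChain_one [DecidableEq W] (hq : q ≠ 0) : leftMulChain cs q 1 = 1 := by
  ext x y
  rw [leftMulChain, one_mul, normT, map_smul, Finsupp.smul_apply, repr_T, Matrix.one_apply]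
  split_ifs with h
  · subst h
    have := pow_ne_zero (cs.length x) hq
    simp [this]
  · simp

theorem leftMulChain_pow [Fintype W] [DecidableEq W] (hq : q ≠ 0) (h : HeckeAlgebra cs q) (n : ℕ) :
    leftMulChain cs q (h ^ n) = leftMulChain cs q h ^ n := by
  induction n with
  | zero => rw [pow_zero, pow_zero, leftMulChain_one cs q hq]
  | succ n ih => rw [pow_succ', leftMulChain_mul cs q hq, ih, pow_succ]

theorem leftMulChain_self (hq : q ≠ 0) (h : HeckeAlgebra cs q) (x : W) :
    leftMulChain cs q h x x = (basisT cs q).repr (h * T cs q x) x := by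
  have := pow_ne_zero (cs.length x) hq
  rw [leftMulChain, normT, mul_smul_comm, map_smul, Finsupp.smul_apply, smul_eq_mul,
    mul_inv_cancel_left₀ this]

theorem pow_mul_leftMulChain (hq : q ≠ 0) (h : HeckeAlgebra cs q) (x y : W) :
    q ^ cs.length x * leftMulChain cs q h x y = tau cs q (T cs q y⁻¹ * (h * T cs q x)) := by
  have := pow_ne_zero (cs.length x) hq
  rw [leftMulChain, ← pow_mul_repr, normT, mul_smul_comm, map_smul, Finsupp.smul_apply,
    smul_eq_mul]
  field_simp

/-- Detailed balance up to the factor `P_W(q)`: the left side is `tau (T y⁻¹ * h * T x)`, and `flip`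
preserves `tau` while exchanging `x` and `y`. -/
theorem pow_mul_leftMulChain_comm (hq : q ≠ 0) {h : HeckeAlgebra cs q} (hh : flip cs q h = h)
    (x y : W) :
    q ^ cs.length x * leftMulChain cs q h x y = q ^ cs.length y * leftMulChain cs q h y x := by
  rw [pow_mul_leftMulChain cs q hq, pow_mul_leftMulChain cs q hq, ← tau_flip, flip_mul, flip_mul,
    flip_T, flip_T, hh, inv_inv, mul_assoc]

theorem index_normT (hq : q ≠ 0) (w : W) : index cs q (normT cs q w) = 1 := by
  rw [normT, map_smul, index_T, smul_eq_mul, inv_mul_cancel₀ (pow_ne_zero _ hq)]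

/-- Apply the index representation, which sends every normalized basis element to `1`, to the
expansion of `h * normT x`. -/
theorem sum_leftMulChain [Fintype W] (hq : q ≠ 0) {h : HeckeAlgebra cs q} (hh : index cs q h = 1)
    (x : W) : ∑ y, leftMulChain cs q h x y = 1 := by
  have := congrArg (index cs q) (mul_normT_eq_sum cs q hq h x)
  rw [map_mul, hh, index_normT cs q hq, map_sum] at this
  simp only [map_smul, index_normT cs q hq, smul_eq_mul, mul_one] at this
  exact this.symm

theorem flip_normT_longest_sq [Fintype W] {w₀ : W} (hw₀ : ∀ w, cs.length w ≤ cs.length w₀) :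
    flip cs q (normT cs q w₀ ^ 2) = normT cs q w₀ ^ 2 := by
  have : flip cs q (normT cs q w₀) = normT cs q w₀ := by
    rw [normT, map_smul, flip_T, cs.longest_inv hw₀]
  rw [pow_two, flip_mul, this]

end Field

section Real

variable {B W : Type*} [Group W] {M : CoxeterMatrix B} (cs : CoxeterSystem M W)

theorem leftMulChain_normT_sq_nonneg {q : ℝ} (hq : 1 ≤ q) (w x y : W) :
    0 ≤ leftMulChain cs q (normT cs q w ^ 2) x y := by
  classical
  have hq0 : 0 < q := by linarith
  have h := repr_T_mul_nonneg cs hq w (repr_T_mul_nonneg cs hq w (a := T cs q x) (fun _ => by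
    rw [repr_T]; split_ifs <;> norm_num)) y
  simp only [leftMulChain, normT, pow_two, smul_mul_assoc, mul_smul_comm, map_smul,
    Finsupp.smul_apply, smul_eq_mul, mul_assoc]
  positivity

theorem poincare_pos [Fintype W] {q : ℝ} (hq : 0 < q) : 0 < poincare cs q :=
  Finset.sum_pos (fun _ _ => pow_pos hq _) ⟨1, Finset.mem_univ 1⟩

end Real

end HeckeAlgebra

open HeckeAlgebra

theorem isReversibleChain_leftMulChain {B W : Type*} [Group W] [Fintype W] {M : CoxeterMatrix B}
    (cs : CoxeterSystem M W) {θ : ℝ} (hθ₀ : 0 < θ) (hθ₁ : θ ≤ 1) {w₀ : W}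
    (hw₀ : ∀ w, cs.length w ≤ cs.length w₀) :
    IsReversibleChain (lengthDist cs θ) (leftMulChain cs θ⁻¹ (normT cs θ⁻¹ w₀ ^ 2)) := by
  have hq : 0 < θ⁻¹ := inv_pos.2 hθ₀
  have hP := poincare_pos cs hq
  refine ⟨⟨fun x => ?_, ?_⟩, ⟨?_, ?_⟩, fun x y => ?_⟩
  · unfold lengthDist; positivity
  · unfold lengthDist
    rw [← Finset.sum_div]
    exact div_self hP.ne'
  · exact leftMulChain_normT_sq_nonneg cs ((one_le_inv₀ hθ₀).2 hθ₁) w₀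
  · exact sum_leftMulChain cs _ hq.ne' (by rw [map_pow, index_normT cs _ hq.ne', one_pow])
  · unfold lengthDist
    rw [div_mul_eq_mul_div, div_mul_eq_mul_div,
      pow_mul_leftMulChain_comm cs _ hq.ne' (flip_normT_longest_sq cs _ hw₀)]

/-! ### Reversible chains and return probabilities -/

section Chain

variable {X : Type*} [Fintype X] [DecidableEq X] {μ : X → ℝ} {K : Matrix X X ℝ}

theorem IsReversibleChain.pow_comm (h : IsReversibleChain μ K) (n : ℕ) (x y : X) :
    μ x * (K ^ n) x y = μ y * (K ^ n) y x := by
  induction n generalizing x y with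
  | zero =>
    rw [pow_zero, Matrix.one_apply, Matrix.one_apply]
    by_cases e : x = y
    · rw [e]
    · rw [if_neg e, if_neg (Ne.symm e), mul_zero, mul_zero]
  | succ n ih =>
    have e : (K ^ (n + 1)) y x = ∑ z, K y z * (K ^ n) z x := by
      rw [pow_succ', Matrix.mul_apply]
    rw [e, pow_succ, Matrix.mul_apply, Finset.mul_sum, Finset.mul_sum]
    refine Finset.sum_congr rfl fun z _ => ?_
    rw [← mul_assoc, ih, ← mul_assoc, h.2.2 y z]
    ring

theorem IsReversibleChain.sum_pow (h : IsReversibleChain μ K) (n : ℕ) (x : X) :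
    ∑ y, (K ^ n) x y = 1 := by
  induction n generalizing x with
  | zero => simp [Matrix.one_apply]
  | succ n ih =>
    simp only [pow_succ, Matrix.mul_apply]
    rw [Finset.sum_comm]
    simp only [← Finset.mul_sum, h.2.1.2, mul_one, ih]

/-- The `L²` distance to stationarity of a reversible chain is a return probability. -/
theorem IsReversibleChain.chainDistSq_eq (h : IsReversibleChain μ K) (hμ : ∀ x, 0 < μ x)
    (x : X) (n : ℕ) : chainDistSq μ K x n = (K ^ (2 * n)) x x / μ x - 1 := by
  -- Reversibility replaces one factor `K^n(x,y) / μ(y)` by `K^n(y,x) / μ(x)`, so that the quadratic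
  -- term sums to an entry of `K^(2n)`.
  have e : ∀ y, ((K ^ n) x y / μ y - 1) ^ 2 * μ y =
      (K ^ n) x y * (K ^ n) y x / μ x - 2 * (K ^ n) x y + μ y := by
    intro y
    have h1 := h.pow_comm n x y
    have h2 := (hμ x).ne'
    have h3 := (hμ y).ne'
    have h4 : (K ^ n) y x = μ x * (K ^ n) x y / μ y := by rw [h1]; field_simp
    rw [h4]
    field_simp
    ring
  rw [chainDistSq, l2NormSq, Finset.sum_congr rfl fun y _ => e y, Finset.sum_add_distrib,
    Finset.sum_sub_distrib, ← Finset.mul_sum, h.sum_pow, h.1.2, ← Finset.sum_div, two_mul n,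
    pow_add, Matrix.mul_apply]
  ring

end Chain

/-! ### Global solutions of linear differential equations -/

section LinearODE

variable {E : Type*} [NormedAddCommGroup E] [NormedSpace ℝ E]

/-- The terms of the Picard series of the linear differential equation `x' = A x`. -/
noncomputable def picardTerm (A : ℝ → E →L[ℝ] E) (t₀ : ℝ) (x₀ : E) : ℕ → ℝ → E
  | 0, _ => x₀
  | n + 1, t => ∫ s in t₀..t, A s (picardTerm A t₀ x₀ n s)

variable {A : ℝ → E →L[ℝ] E} (t₀ : ℝ) (x₀ : E)

theorem continuous_picardTerm (hA : Continuous A) (n : ℕ) : Continuous (picardTerm A t₀ x₀ n) := by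
  induction n with
  | zero => exact continuous_const
  | succ n ih =>
    exact intervalIntegral.continuous_primitive
      (fun a b => (hA.clm_apply ih).intervalIntegrable a b) t₀

theorem hasDerivAt_picardTerm [CompleteSpace E] (hA : Continuous A) (n : ℕ) (t : ℝ) :
    HasDerivAt (picardTerm A t₀ x₀ (n + 1)) (A t (picardTerm A t₀ x₀ n t)) t :=
  ((hA.clm_apply (continuous_picardTerm t₀ x₀ hA n)).integral_hasStrictDerivAt t₀ t).hasDerivAt

theorem norm_picardTerm_le {C R : ℝ} (hC : 0 ≤ C)
    (hAC : ∀ t, |t - t₀| < R → ‖A t‖ ≤ C) (n : ℕ) (t : ℝ) (ht : |t - t₀| < R) :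
    ‖picardTerm A t₀ x₀ n t‖ ≤ ‖x₀‖ * ((C * |t - t₀|) ^ n / n.factorial) := by
  induction n generalizing t with
  | zero => simp [picardTerm]
  | succ n ih =>
    have hbound : ∀ s ∈ Set.uIoc t₀ t, ‖A s (picardTerm A t₀ x₀ n s)‖ ≤
        ‖x₀‖ * C ^ (n + 1) / n.factorial * |s - t₀| ^ n := by
      intro s hs
      have hs' : |s - t₀| < R := by
        refine lt_of_le_of_lt ?_ ht
        have := Set.uIoc_subset_uIcc hs
        exact Set.abs_sub_left_of_mem_uIcc this
      calc ‖A s (picardTerm A t₀ x₀ n s)‖ ≤ ‖A s‖ * ‖picardTerm A t₀ x₀ n s‖ :=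
            (A s).le_opNorm _
        _ ≤ C * (‖x₀‖ * ((C * |s - t₀|) ^ n / n.factorial)) :=
            mul_le_mul (hAC s hs') (ih s hs') (norm_nonneg _) hC
        _ = _ := by rw [mul_pow]; ring
    calc ‖picardTerm A t₀ x₀ (n + 1) t‖
        = ‖∫ s in t₀..t, A s (picardTerm A t₀ x₀ n s)‖ := rfl
      _ ≤ |∫ s in t₀..t, ‖x₀‖ * C ^ (n + 1) / n.factorial * |s - t₀| ^ n| := by
          refine intervalIntegral.norm_integral_le_abs_of_norm_le ?_ ?_
          · exact (MeasureTheory.ae_restrict_mem measurableSet_uIoc).mono hbound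
          · exact Continuous.intervalIntegrable (by fun_prop) _ _
      _ = ‖x₀‖ * C ^ (n + 1) / n.factorial * (|t - t₀| ^ (n + 1) / (n + 1)) := by
          rw [intervalIntegral.abs_intervalIntegral_eq, MeasureTheory.integral_const_mul,
            integral_pow_abs_sub_uIoc, abs_of_nonneg]
          positivity
      _ = _ := by
          rw [mul_pow, Nat.factorial_succ]
          push_cast
          field_simp

/-- Linear differential equations with continuous coefficients have global solutions. -/
theorem exists_forall_hasDerivAt_linear [CompleteSpace E] (hA : Continuous A) :
    ∃ x : ℝ → E, x t₀ = x₀ ∧ ∀ t, HasDerivAt x (A t (x t)) t := by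
  -- On each ball `A` is bounded by compactness, so the exponential series dominates both the Picard
  -- terms and their derivatives. The radius is arbitrary, hence the solution is global.
  have key : ∀ R : ℝ, ∃ u : ℕ → ℝ, Summable u ∧
      (∀ n, ∀ t ∈ Metric.ball t₀ R, ‖picardTerm A t₀ x₀ n t‖ ≤ u n) ∧
      ∃ v : ℕ → ℝ, Summable v ∧
      (∀ n, ∀ t ∈ Metric.ball t₀ R, ‖A t (picardTerm A t₀ x₀ n t)‖ ≤ v n) := by
    intro R
    obtain ⟨C, hC⟩ := (isCompact_closedBall t₀ R).exists_bound_of_continuousOn hA.continuousOn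
    have hAC : ∀ t, |t - t₀| < R → ‖A t‖ ≤ max C 0 := fun t ht =>
      (hC t (by rw [Metric.mem_closedBall, Real.dist_eq]; exact ht.le)).trans (le_max_left _ _)
    have h0 : 0 ≤ max C 0 := le_max_right _ _
    have hb : ∀ n, ∀ t ∈ Metric.ball t₀ R, ‖picardTerm A t₀ x₀ n t‖ ≤
        ‖x₀‖ * ((max C 0 * R) ^ n / n.factorial) := by
      intro n t ht
      rw [Metric.mem_ball, Real.dist_eq] at ht
      refine (norm_picardTerm_le t₀ x₀ h0 hAC n t ht).trans ?_
      gcongr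
    have hs := (Real.summable_pow_div_factorial (max C 0 * R)).mul_left ‖x₀‖
    refine ⟨_, hs, hb, _, hs.mul_left (max C 0), fun n t ht => ?_⟩
    refine ((A t).le_opNorm _).trans (mul_le_mul ?_ (hb n t ht) (norm_nonneg _) h0)
    rw [Metric.mem_ball, Real.dist_eq] at ht
    exact hAC t ht
  refine ⟨fun t => ∑' n, picardTerm A t₀ x₀ n t, ?_, fun t => ?_⟩
  · change ∑' n, picardTerm A t₀ x₀ n t₀ = x₀
    rw [tsum_eq_single 0]
    · rfl
    · intro n hn
      obtain ⟨m, rfl⟩ := Nat.exists_eq_succ_of_ne_zero hn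
      simp [picardTerm]
  · obtain ⟨u, hu, hub, v, hv, hvb⟩ := key (|t - t₀| + 1)
    have ht : t ∈ Metric.ball t₀ (|t - t₀| + 1) := by
      rw [Metric.mem_ball, Real.dist_eq]; linarith
    have ht0 : t₀ ∈ Metric.ball t₀ (|t - t₀| + 1) := by
      rw [Metric.mem_ball, dist_self]; positivity
    have hsum : Summable fun n => picardTerm A t₀ x₀ n t :=
      Summable.of_norm_bounded hu fun n => hub n t ht
    have hd := hasDerivAt_tsum_of_isPreconnected (g := fun n => picardTerm A t₀ x₀ (n + 1))
      (g' := fun n t => A t (picardTerm A t₀ x₀ n t)) hv Metric.isOpen_ball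
      (convex_ball _ _).isPreconnected (fun n t _ => hasDerivAt_picardTerm t₀ x₀ hA n t) hvb ht0
      ((summable_nat_add_iff 1).2 (Summable.of_norm_bounded hu fun n => hub n t₀ ht0)) ht
    rw [← ContinuousLinearMap.map_tsum _ hsum] at hd
    refine (hd.const_add x₀).congr_of_eventuallyEq ?_
    filter_upwards [Metric.isOpen_ball.mem_nhds ht] with s hs
    exact (Summable.of_norm_bounded hu fun n => hub n s hs).tsum_eq_zero_add

end LinearODE

/-! ### Integrating an infinitesimally trivial deformation -/

section Deformation

variable {V : Type*} [NormedAddCommGroup V] [NormedSpace ℝ V] [FiniteDimensional ℝ V]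

/-- A family of products `m q` whose derivative is the coboundary of a continuous family of
operators is trivial: it is obtained from `m 1` by a continuous change of coordinates. -/
theorem exists_trivialization (m m' : ℝ → V →L[ℝ] V →L[ℝ] V) (D : ℝ → V →L[ℝ] V)
    (hm : ∀ q, 1 ≤ q → HasDerivAt m (m' q) q) (hD : ContinuousOn D (Set.Ici 1))
    (h : ∀ q, 1 ≤ q → ∀ a b,
      D q (m q a b) = m q (D q a) b + m q a (D q b) + m' q a b) :
    ∃ G H : ℝ → V →L[ℝ] V, Continuous G ∧ Continuous H ∧ G 1 = 1 ∧ H 1 = 1 ∧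
      ∀ q, 1 ≤ q → H q * G q = 1 ∧ G q * H q = 1 ∧
        ∀ a b, G q (m 1 a b) = m q (G q a) (G q b) := by
  have : CompleteSpace V := FiniteDimensional.complete ℝ V
  -- Freezing `D` to the left of `1` gives coefficients continuous on all of `ℝ`.
  let D' : ℝ → V →L[ℝ] V := fun q => D (max q 1)
  have hD' : Continuous D' := by
    exact continuousOn_univ.1 (hD.comp (by fun_prop) fun q _ => le_max_right q 1)
  obtain ⟨G, hG1, hG⟩ := exists_forall_hasDerivAt_linear
    (A := fun q => ContinuousLinearMap.mul ℝ (V →L[ℝ] V) (D' q)) 1 (1 : V →L[ℝ] V)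
    (by fun_prop)
  -- `H` solves the adjoint equation `H' = -H D`, so `H G` is constant and `H` inverts `G`.
  obtain ⟨H, hH1, hH⟩ := exists_forall_hasDerivAt_linear
    (A := fun q => -(ContinuousLinearMap.mul ℝ (V →L[ℝ] V)).flip (D' q)) 1 (1 : V →L[ℝ] V)
    (by fun_prop)
  simp only [ContinuousLinearMap.mul_apply', neg_apply,
    ContinuousLinearMap.flip_apply] at hG hH
  have hcG : Continuous G := continuous_iff_continuousAt.2 fun q => (hG q).continuousAt
  have hcH : Continuous H := continuous_iff_continuousAt.2 fun q => (hH q).continuousAt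
  have hHG : ∀ q, H q * G q = 1 := by
    have hd : ∀ q, HasDerivAt (fun q => H q * G q) 0 q := by
      intro q
      have := (hH q).mul (hG q)
      rw [neg_mul, mul_assoc, neg_add_cancel] at this
      exact this
    intro q
    have := is_const_of_deriv_eq_zero (fun q => (hd q).differentiableAt) (fun q => (hd q).deriv) q 1
    simpa [hG1, hH1] using this
  -- In finite dimension a one-sided inverse is two-sided.
  have hGH : ∀ q, G q * H q = 1 := by
    intro q
    ext v
    have h1 : ((G q : V →ₗ[ℝ] V) * (H q : V →ₗ[ℝ] V)) = 1 := by
      rw [mul_eq_one_comm]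
      ext v
      exact congrArg (fun f : V →L[ℝ] V => f v) (hHG q)
    exact LinearMap.congr_fun h1 v
  refine ⟨G, H, hcG, hcH, hG1, hH1, fun q hq => ⟨hHG q, hGH q, fun a b => ?_⟩⟩
  -- The product pulled back along `G` is stationary: the derivatives of both arguments and of `m`
  -- add up to `D (m (G a) (G b))`, which the derivative of `H` cancels.
  have hF : ∀ p, 1 ≤ p → HasDerivAt (fun p => H p (m p (G p a) (G p b))) 0 p := by
    intro p hp
    have hGa : ∀ a, HasDerivAt (fun p => G p a) (D p (G p a)) p := by
      intro a
      have := (hG p).clm_apply (hasDerivAt_const p a)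
      simpa [D', max_eq_left hp] using this
    have h1 := (hH p).clm_apply (((hm p hp).clm_apply (hGa a)).clm_apply (hGa b))
    convert h1 using 1
    simp only [D', max_eq_left hp, neg_apply,
      mul_apply_eq_comp, add_apply]
    rw [h p hp]
    simp only [map_add]
    abel
  have hc := constant_of_has_deriv_right_zero (a := 1) (b := q)
    (f := fun p => H p (m p (G p a) (G p b)))
    (fun p hp => (hF p hp.1).continuousAt.continuousWithinAt)
    (fun p hp => (hF p hp.1).hasDerivWithinAt) q ⟨hq, le_rfl⟩
  simp only [hG1, hH1, one_apply_eq_self] at hc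
  rw [← hc, ← mul_apply_eq_comp, hGH, one_apply_eq_self]

end Deformation

/-! ### Splitting a Hochschild 2-cocycle -/

section Cocycle

variable {V ι : Type*} [NormedAddCommGroup V] [NormedSpace ℝ V] [Fintype ι]

/-- A separability element turns a Hochschild `2`-cocycle into a coboundary. -/
theorem coboundary_of_separability (m m' : V →L[ℝ] V →L[ℝ] V) (x y : ι → V) (R : V →L[ℝ] V)
    (hassoc : ∀ a b c, m (m a b) c = m a (m b c))
    (hcocycle : ∀ a b c, m' (m a b) c + m (m' a b) c = m' a (m b c) + m a (m' b c))
    (hslide : ∀ a b, ∑ i, m (m a (x i)) (m' (y i) b) = ∑ i, m (x i) (m' (m (y i) a) b))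
    (hcentral : ∀ a, m a (∑ i, m (x i) (y i)) = m (∑ i, m (x i) (y i)) a)
    (hR : ∀ v, R (m (∑ i, m (x i) (y i)) v) = v) (hR' : ∀ v, m (∑ i, m (x i) (y i)) (R v) = v)
    (D : V →L[ℝ] V) (hD : ∀ b, D b = -∑ i, R (m (x i) (m' (y i) b))) (a b : V) :
    D (m a b) = m (D a) b + m a (D b) + m' a b := by
  set C := ∑ i, m (x i) (y i) with hC
  -- `R` inverts multiplication by the central element `C`, hence commutes with left and right
  -- multiplications.
  have hRl : ∀ u v, R (m u v) = m u (R v) := by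
    intro u v
    conv_lhs => rw [← hR' v, ← hassoc, hcentral, hassoc, hR]
  have hRr : ∀ u v, R (m u v) = m (R u) v := by
    intro u v
    conv_lhs => rw [← hR' u, hassoc, hR]
  -- The cocycle identity for `(y i, a, b)`, multiplied by `x i`. After summation the three terms
  -- become `-a · D b` (by sliding `a` across), `-D a · b`, and `m' a b` (since `R` cancels `C`).
  have e : ∀ i, R (m (x i) (m' (y i) (m a b))) = R (m (x i) (m' (m (y i) a) b)) +
      m (R (m (x i) (m' (y i) a))) b - R (m (m (x i) (y i)) (m' a b)) := by
    intro i
    rw [eq_sub_of_add_eq (hcocycle (y i) a b).symm, map_sub, map_add, map_sub, map_add, ← hassoc,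
      hRr (m (x i) (m' (y i) a)), hassoc (x i) (y i)]
  have e1 : ∑ i, R (m (x i) (m' (m (y i) a) b)) = m a (∑ i, R (m (x i) (m' (y i) b))) := by
    rw [← map_sum, ← hslide, map_sum, map_sum]
    refine Finset.sum_congr rfl fun i _ => ?_
    rw [hassoc, hRl]
  have e2 : ∑ i, R (m (m (x i) (y i)) (m' a b)) = m' a b := by
    have : ∑ i, R (m (m (x i) (y i)) (m' a b)) = R (m C (m' a b)) := by
      rw [hC, map_sum, sum_apply, map_sum]
    rw [this, hR]
  have e3 : ∑ i, m (R (m (x i) (m' (y i) a))) b = m (∑ i, R (m (x i) (m' (y i) a))) b := by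
    rw [map_sum, sum_apply]
  rw [hD, hD a, hD b, Finset.sum_congr rfl fun i _ => e i, Finset.sum_sub_distrib,
    Finset.sum_add_distrib, e1, e2, e3, map_neg, map_neg, neg_apply]
  abel

end Cocycle

/-! ### The separability element and the Casimir element of the Hecke algebra -/

namespace HeckeAlgebra

section Field

variable {B W F : Type*} [Group W] [Field F] {M : CoxeterMatrix B}
  (cs : CoxeterSystem M W) (q : F)

/-- The tensor `∑ q^(-ℓ w) T w ⊗ T w⁻¹` of dual bases has equal left and right products with `a`; it
is tested against an arbitrary bilinear `ψ`. Expanding in the dual bases, the coefficients agree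
because `tau` is a trace. -/
theorem sum_slide [Fintype W] (hq : q ≠ 0) {N : Type*} [AddCommGroup N] [Module F N]
    (ψ : HeckeAlgebra cs q →ₗ[F] HeckeAlgebra cs q →ₗ[F] N) (a : HeckeAlgebra cs q) :
    ∑ w, (q ^ cs.length w)⁻¹ • ψ (a * T cs q w) (T cs q w⁻¹) =
      ∑ w, (q ^ cs.length w)⁻¹ • ψ (T cs q w) (T cs q w⁻¹ * a) := by
  have h : ∀ b y, (basisT cs q).repr b y = (q ^ cs.length y)⁻¹ * tau cs q (T cs q y⁻¹ * b) := by
    intro b y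
    rw [← pow_mul_repr, inv_mul_cancel_left₀ (pow_ne_zero _ hq)]
  have h1 : ∀ w, (q ^ cs.length w)⁻¹ • ψ (a * T cs q w) (T cs q w⁻¹) =
      ∑ y, ((q ^ cs.length w)⁻¹ * (q ^ cs.length y)⁻¹ *
        tau cs q (T cs q y⁻¹ * (a * T cs q w))) • ψ (T cs q y) (T cs q w⁻¹) := by
    intro w
    conv_lhs => rw [eq_sum_repr cs q (a * T cs q w)]
    simp only [map_sum, map_smul, LinearMap.sum_apply, LinearMap.smul_apply, Finset.smul_sum,
      smul_smul, h, mul_assoc]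
  have h2 : ∀ w, (q ^ cs.length w)⁻¹ • ψ (T cs q w) (T cs q w⁻¹ * a) =
      ∑ y, ((q ^ cs.length w)⁻¹ * (q ^ cs.length y)⁻¹ *
        tau cs q (T cs q y * (T cs q w⁻¹ * a))) • ψ (T cs q w) (T cs q y⁻¹) := by
    intro w
    conv_lhs => rw [eq_sum_repr cs q (T cs q w⁻¹ * a)]
    rw [← Equiv.sum_comp (Equiv.inv W)]
    simp only [map_sum, map_smul, Finset.smul_sum, Equiv.inv_apply,
      smul_smul, h, mul_assoc, inv_inv, cs.length_inv]
  rw [Finset.sum_congr rfl fun w _ => h1 w, Finset.sum_congr rfl fun w _ => h2 w,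
    Finset.sum_comm]
  refine Finset.sum_congr rfl fun y _ => Finset.sum_congr rfl fun w _ => ?_
  rw [← mul_assoc, tau_mul_comm, mul_comm (q ^ cs.length w)⁻¹]

/-- The central element `∑ q ^ (-ℓ(w)) T w T w⁻¹`. -/
noncomputable def casimir [Fintype W] : HeckeAlgebra cs q :=
  ∑ w, (q ^ cs.length w)⁻¹ • (T cs q w * T cs q w⁻¹)

theorem casimir_central [Fintype W] (hq : q ≠ 0) (a : HeckeAlgebra cs q) :
    a * casimir cs q = casimir cs q * a := by
  have := sum_slide cs q hq (LinearMap.mul F (HeckeAlgebra cs q)) a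
  simp only [LinearMap.mul_apply'] at this
  rw [casimir, Finset.mul_sum, Finset.sum_mul]
  simp only [mul_smul_comm, smul_mul_assoc, ← mul_assoc] at this ⊢
  exact this

/-- Over `ℝ` with `q > 0` this makes `(a, b) ↦ tau (flip a * b)` positive definite. -/
theorem tau_flip_mul_self [Fintype W] (b : HeckeAlgebra cs q) :
    tau cs q (flip cs q b * b) = ∑ w, q ^ cs.length w * (basisT cs q).repr b w ^ 2 := by
  have : flip cs q b = ∑ w, (basisT cs q).repr b w • T cs q w⁻¹ := by
    conv_lhs => rw [eq_sum_repr cs q b]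
    simp only [map_sum, map_smul, flip_T]
  rw [this, Finset.sum_mul, map_sum]
  refine Finset.sum_congr rfl fun w _ => ?_
  rw [smul_mul_assoc, map_smul, ← pow_mul_repr, smul_eq_mul]
  ring

end Field

section Real

variable {B W : Type*} [Group W] [Fintype W] {M : CoxeterMatrix B} (cs : CoxeterSystem M W)

/-- The number `tau (flip a * casimir * a)` is a sum of nonnegative terms whose `w = 1` term is `tau
(flip a * a)`. This positivity is why the deformation is integrated over `ℝ` before passing to `ℂ`.
-/
theorem eq_zero_of_casimir_mul {q : ℝ} (hq : 0 < q) {a : HeckeAlgebra cs q}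
    (ha : casimir cs q * a = 0) : a = 0 := by
  have hnn : ∀ b : HeckeAlgebra cs q, 0 ≤ tau cs q (flip cs q b * b) := by
    intro b
    rw [tau_flip_mul_self]
    exact Finset.sum_nonneg fun w _ => by positivity
  have h : tau cs q (flip cs q a * (casimir cs q * a)) =
      ∑ w, (q ^ cs.length w)⁻¹ *
        tau cs q (flip cs q (T cs q w⁻¹ * a) * (T cs q w⁻¹ * a)) := by
    rw [casimir, Finset.sum_mul, Finset.mul_sum, map_sum]
    refine Finset.sum_congr rfl fun w _ => ?_
    rw [smul_mul_assoc, mul_smul_comm, map_smul, flip_mul, flip_T, inv_inv, smul_eq_mul]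
    simp only [mul_assoc]
  rw [ha, mul_zero, map_zero] at h
  have h1 := (Finset.sum_eq_zero_iff_of_nonneg fun w _ =>
    mul_nonneg (inv_nonneg.2 (pow_nonneg hq.le _)) (hnn (T cs q w⁻¹ * a))).1 h.symm 1
      (Finset.mem_univ 1)
  rw [inv_one, ← one_def, one_mul, cs.length_one, pow_zero, inv_one, one_mul,
    tau_flip_mul_self] at h1
  refine (basisT cs q).repr.injective (Finsupp.ext fun w => ?_)
  have h2 := (Finset.sum_eq_zero_iff_of_nonneg fun w _ => by positivity).1 h1 w (Finset.mem_univ w)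
  have h3 := (pow_pos hq (cs.length w)).ne'
  simpa [h3] using h2

end Real

/-! ### Dependence of the product on the parameter -/

section Polynomial

open Polynomial

variable {B W : Type*} [Group W] [Fintype W] {M : CoxeterMatrix B} (cs : CoxeterSystem M W)

/-- The polynomial is chosen before `q`, so a single family of polynomials describes all the
products and can be differentiated. -/
theorem exists_structure_polynomial (R : Type*) [CommRing R] (x y z : W) :
    ∃ p : R[X], ∀ q : R, (basisT cs q).repr (T cs q x * T cs q y) z = p.eval q := by
  classical
  have h0 : ∀ w z, ∃ p : R[X], ∀ q : R, (basisT cs q).repr (T cs q w) z = p.eval q := by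
    intro w z
    refine ⟨if w = z then 1 else 0, fun q => ?_⟩
    rw [repr_T]
    split_ifs <;> simp
  have h1 : ∀ i w z, ∃ p : R[X], ∀ q : R,
      (basisT cs q).repr (T cs q (cs.simple i) * T cs q w) z = p.eval q := by
    intro i w z
    obtain ⟨p, hp⟩ := h0 w z
    obtain ⟨r, hr⟩ := h0 (cs.simple i * w) z
    by_cases h : cs.length w < cs.length (cs.simple i * w)
    · refine ⟨r, fun q => ?_⟩
      rw [T_simple_mul_T, if_pos h, hr]
    · refine ⟨(X - 1) * p + X * r, fun q => ?_⟩
      rw [T_simple_mul_T, if_neg h, map_add, map_smul, map_smul, Finsupp.add_apply,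
        Finsupp.smul_apply, Finsupp.smul_apply, hr, hp]
      simp
  induction x using length_induction_left cs generalizing y z with
  | one => simpa only [← one_def, one_mul] using h0 y z
  | mul i w hw ih =>
    choose p hp using fun u => ih y u
    choose r hr using fun u => h1 i u z
    refine ⟨∑ u, p u * r u, fun q => ?_⟩
    rw [← T_simple_mul_of_lt cs q hw, mul_assoc, eq_sum_repr cs q (T cs q w * T cs q y),
      Finset.mul_sum, map_sum, Finsupp.finsetSum_apply, eval_finsetSum]
    refine Finset.sum_congr rfl fun u _ => ?_
    rw [mul_smul_comm, map_smul, Finsupp.smul_apply, hr, hp, eval_mul, smul_eq_mul]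

end Polynomial

section Trivialization

/-- The bilinear map `(u, v) ↦ u x * v y` with values in the coordinate `z`. -/
noncomputable def coordBilin {W : Type*} [Fintype W] [DecidableEq W] (i : W × W × W) :
    (W → ℝ) →L[ℝ] (W → ℝ) →L[ℝ] (W → ℝ) :=
  (ContinuousLinearMap.proj (R := ℝ) (φ := fun _ : W => ℝ) i.1).smulRight
    ((ContinuousLinearMap.proj (R := ℝ) (φ := fun _ : W => ℝ) i.2.1).smulRight
      (Pi.single i.2.2 (1 : ℝ)))

theorem coordBilin_apply {W : Type*} [Fintype W] [DecidableEq W] (i : W × W × W) (u v : W → ℝ) :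
    coordBilin i u v = (u i.1 * v i.2.1) • (Pi.single i.2.2 (1 : ℝ) : W → ℝ) := by
  rw [mul_smul]
  rfl

variable {B W : Type*} [Group W] [Fintype W] {M : CoxeterMatrix B} (cs : CoxeterSystem M W)

open Polynomial in
theorem _root_.hasDerivAt_sum_eval_smul {ι E : Type*} [Fintype ι] [NormedAddCommGroup E]
    [NormedSpace ℝ E] (p : ι → ℝ[X]) (v : ι → E) (q : ℝ) :
    HasDerivAt (fun q => ∑ i, (p i).eval q • v i) (∑ i, (derivative (p i)).eval q • v i) q :=
  HasDerivAt.fun_sum fun i _ => ((p i).hasDerivAt q).smul_const (v i)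

open Polynomial in
theorem _root_.continuous_sum_eval_smul {ι E : Type*} [Fintype ι] [NormedAddCommGroup E]
    [NormedSpace ℝ E] (p : ι → ℝ[X]) (v : ι → E) :
    Continuous fun q : ℝ => ∑ i, (p i).eval q • v i :=
  continuous_finsetSum _ fun i _ => (p i).continuous.smul continuous_const

open Polynomial in
/-- The product of the real Hecke algebra, in coordinates, is a differentiable function of the
parameter. -/
theorem exists_hasDerivAt_mul :
    ∃ m m' : ℝ → (W → ℝ) →L[ℝ] (W → ℝ) →L[ℝ] (W → ℝ),
      (∀ (q : ℝ) (a b : HeckeAlgebra cs q), (basisT cs q).equivFun (a * b) =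
        m q ((basisT cs q).equivFun a) ((basisT cs q).equivFun b)) ∧
      (∀ q, HasDerivAt m (m' q) q) ∧ Continuous m ∧ Continuous m' := by
  classical
  choose p hp using exists_structure_polynomial cs ℝ
  let r : W × W × W → ℝ[X] := fun i => p i.1 i.2.1 i.2.2
  have hd := hasDerivAt_sum_eval_smul r (coordBilin (W := W))
  have hc := continuous_sum_eval_smul r (coordBilin (W := W))
  have hc' := continuous_sum_eval_smul (fun i => derivative (r i)) (coordBilin (W := W))
  refine ⟨_, _, fun q a b => ?_, hd, hc, hc'⟩
  conv_lhs => rw [eq_sum_repr cs q a, eq_sum_repr cs q b]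
  ext z
  simp only [Finset.sum_mul_sum, smul_mul_smul_comm, sum_apply, smul_apply,
    coordBilin_apply, Finset.sum_apply, Pi.smul_apply, Pi.single_apply, Fintype.sum_prod_type,
    Module.Basis.equivFun_apply, map_sum, map_smul,
    hp, r, smul_eq_mul, mul_ite, mul_one, mul_zero, Finset.sum_ite_eq, Finset.mem_univ, if_true]
  refine Finset.sum_congr rfl fun x _ => Finset.sum_congr rfl fun y _ => ?_
  ring

end Trivialization

end HeckeAlgebra

/-! ### Trivializing the family of real Hecke algebras -/

namespace HeckeAlgebra

section Trivialization

variable {B W : Type*} [Group W] [Fintype W] {M : CoxeterMatrix B} (cs : CoxeterSystem M W)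

/-- The real Hecke algebras with parameter `q ≥ 1` are isomorphic, by isomorphisms which depend
continuously on `q`. -/
theorem exists_real_trivialization :
    ∃ G H : ℝ → (W → ℝ) →L[ℝ] (W → ℝ), Continuous G ∧ Continuous H ∧ G 1 = 1 ∧ H 1 = 1 ∧
      ∀ q, 1 ≤ q → H q * G q = 1 ∧ G q * H q = 1 ∧
        ∀ a b : HeckeAlgebra cs (1 : ℝ),
          (basisT cs q).equivFun.symm (G q ((basisT cs (1 : ℝ)).equivFun (a * b))) =
            (basisT cs q).equivFun.symm (G q ((basisT cs (1 : ℝ)).equivFun a)) *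
              (basisT cs q).equivFun.symm (G q ((basisT cs (1 : ℝ)).equivFun b)) := by
  classical
  obtain ⟨m, m', hm, hd, hcm, hm'⟩ := exists_hasDerivAt_mul cs
  have hms : ∀ (q : ℝ) (u v : W → ℝ), m q u v = (basisT cs q).equivFun
      ((basisT cs q).equivFun.symm u * (basisT cs q).equivFun.symm v) := by
    intro q u v
    rw [hm, LinearEquiv.apply_symm_apply, LinearEquiv.apply_symm_apply]
  have hassoc : ∀ (q : ℝ) (a b c : W → ℝ), m q (m q a b) c = m q a (m q b c) := by
    intro q a b c
    simp only [hms, LinearEquiv.symm_apply_apply, mul_assoc]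
  -- Differentiate the associativity law in `q`.
  have hcocycle : ∀ (q : ℝ) (a b c : W → ℝ), m' q (m q a b) c + m q (m' q a b) c =
      m' q a (m q b c) + m q a (m' q b c) := by
    intro q a b c
    have k := fun v : W → ℝ => hasDerivAt_const q v
    have h1 := ((hd q).clm_apply (((hd q).clm_apply (k a)).clm_apply (k b))).clm_apply (k c)
    have h2 := ((hd q).clm_apply (k a)).clm_apply (((hd q).clm_apply (k b)).clm_apply (k c))
    simp only [hassoc] at h1
    simpa using h1.unique h2
  have eT : ∀ (q : ℝ) (w : W), (basisT cs q).equivFun (T cs q w) = Pi.single w 1 := by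
    intro q w
    ext y
    rw [Module.Basis.equivFun_apply, repr_T, Pi.single_apply]
    simp only [eq_comm]
  have eT' : ∀ (q : ℝ) (w : W), (basisT cs q).equivFun.symm (Pi.single w 1) = T cs q w := by
    intro q w
    rw [← eT, LinearEquiv.symm_apply_apply]
  -- Coordinates of the two legs of the separability element; only the first depends on `q`.
  let x : ℝ → W → W → ℝ := fun q w => (q ^ cs.length w)⁻¹ • Pi.single w 1
  let y : W → W → ℝ := fun w => Pi.single w⁻¹ 1
  let C : ℝ → W → ℝ := fun q => ∑ w, m q (x q w) (y w)
  have hC : ∀ q, C q = (basisT cs q).equivFun (casimir cs q) := by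
    intro q
    simp only [C, casimir, map_sum, map_smul, hm, eT, x, y, smul_apply]
  -- Injectivity of multiplication by the Casimir element suffices in finite dimension.
  -- Invertibility in the normed ring of operators also makes the inverse continuous in `q`.
  have hunit : ∀ q, 1 ≤ q → IsUnit (m q (C q)) := by
    intro q hq
    rw [ContinuousLinearMap.isUnit_iff_bijective]
    have hinj : Function.Injective (m q (C q)).toLinearMap := by
      rw [← LinearMap.ker_eq_bot, LinearMap.ker_eq_bot']
      intro v hv
      change m q (C q) v = 0 at hv
      rw [hms, hC, LinearEquiv.symm_apply_apply, LinearEquiv.map_eq_zero_iff] at hv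
      exact (LinearEquiv.map_eq_zero_iff _).1
        (eq_zero_of_casimir_mul cs (zero_lt_one.trans_le hq) hv)
    exact ⟨hinj, LinearMap.injective_iff_surjective.1 hinj⟩
  let R : ℝ → (W → ℝ) →L[ℝ] (W → ℝ) := fun q => Ring.inverse (m q (C q))
  let D : ℝ → (W → ℝ) →L[ℝ] (W → ℝ) := fun q => -∑ w, R q * (m q (x q w) * m' q (y w))
  have hcx : ∀ w, ContinuousOn (fun q => x q w) (Set.Ici 1) := by
    intro w
    have h : ContinuousOn (fun q : ℝ => (q ^ cs.length w)⁻¹) (Set.Ici 1) :=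
      (continuous_pow _).continuousOn.inv₀ fun q hq =>
        (pow_pos (zero_lt_one.trans_le hq) _).ne'
    exact h.smul continuousOn_const
  have hcmx : ∀ w, ContinuousOn (fun q => m q (x q w)) (Set.Ici 1) := fun w =>
    hcm.continuousOn.clm_apply (hcx w)
  have hcC : ContinuousOn C (Set.Ici 1) :=
    continuousOn_finsetSum _ fun w _ => (hcmx w).clm_apply continuousOn_const
  have hcR : ContinuousOn R (Set.Ici 1) := by
    intro q hq
    obtain ⟨u, hu⟩ := hunit q hq
    have h1 : ContinuousAt Ring.inverse (m q (C q)) := hu ▸ NormedRing.inverse_continuousAt u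
    have h2 : ContinuousWithinAt (fun q => m q (C q)) (Set.Ici 1) q :=
      (hcm.continuousOn.clm_apply hcC) q hq
    exact ContinuousAt.comp_continuousWithinAt (f := fun q => m q (C q)) h1 h2
  have hcD : ContinuousOn D (Set.Ici 1) := by
    refine (continuousOn_finsetSum _ fun w _ => ?_).neg
    exact hcR.mul ((hcmx w).mul (hm'.continuousOn.clm_apply continuousOn_const))
  have hDer : ∀ q, 1 ≤ q → ∀ a b,
      D q (m q a b) = m q (D q a) b + m q a (D q b) + m' q a b := by
    intro q hq
    have hq0 : q ≠ 0 := (zero_lt_one.trans_le hq).ne'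
    have hu := hunit q hq
    refine coboundary_of_separability (m q) (m' q) (x q) y (R q) (hassoc q) (hcocycle q) ?_ ?_
      ?_ ?_ (D q) ?_
    · intro a b
      have h := sum_slide cs q hq0 (((m q).toLinearMap₁₂.compl₁₂
        (basisT cs q).equivFun.toLinearMap
        (((m' q).flip b).toLinearMap ∘ₗ (basisT cs q).equivFun.toLinearMap)))
        ((basisT cs q).equivFun.symm a)
      simp only [LinearMap.compl₁₂_apply, LinearMap.comp_apply, LinearEquiv.coe_coe,
        ContinuousLinearMap.toLinearMap₁₂_apply, ContinuousLinearMap.coe_coe,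
        ContinuousLinearMap.flip_apply, hm, eT, LinearEquiv.apply_symm_apply] at h
      simp only [x, y, map_smul, smul_apply]
      exact h
    · intro a
      change m q a (C q) = m q (C q) a
      rw [hms, hms q (C q), hC, LinearEquiv.symm_apply_apply, casimir_central cs q hq0]
    · intro v
      change (R q * m q (C q)) v = v
      rw [Ring.inverse_mul_cancel _ hu, one_apply_eq_self]
    · intro v
      change (m q (C q) * R q) v = v
      rw [Ring.mul_inverse_cancel _ hu, one_apply_eq_self]
    · intro b
      simp only [D, neg_apply, sum_apply, mul_apply_eq_comp]
  obtain ⟨G, H, hG, hH, hG1, hH1, h⟩ :=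
    exists_trivialization m m' D (fun q _ => hd q) hcD hDer
  refine ⟨G, H, hG, hH, hG1, hH1, fun q hq => ⟨(h q hq).1, (h q hq).2.1, fun a b => ?_⟩⟩
  rw [hm, (h q hq).2.2, hms, LinearEquiv.symm_apply_apply]

end Trivialization

end HeckeAlgebra

/-! ### Passage to the complex Hecke algebras and the group algebra -/

namespace HeckeAlgebra

section Complexify

variable {B W : Type*} [Group W] {M : CoxeterMatrix B} (cs : CoxeterSystem M W)

/-- The embedding of the real Hecke algebra into the complex one. -/
noncomputable def mapC (q : ℝ) : HeckeAlgebra cs q →+* HeckeAlgebra cs (q : ℂ) :=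
  map cs q Complex.ofRealHom

theorem mapC_T (q : ℝ) (w : W) : mapC cs q (T cs q w) = T cs (q : ℂ) w :=
  map_T cs q Complex.ofRealHom w

theorem mapC_smul (q r : ℝ) (x : HeckeAlgebra cs q) :
    mapC cs q (r • x) = (r : ℂ) • mapC cs q x :=
  map_smul' cs q Complex.ofRealHom r x

theorem repr_mapC (q : ℝ) (x : HeckeAlgebra cs q) (w : W) :
    (basisT cs (q : ℂ)).repr (mapC cs q x) w = ((basisT cs q).repr x w : ℝ) := rfl

theorem mapC_normT (q : ℝ) (w : W) : mapC cs q (normT cs q w) = normT cs (q : ℂ) w := by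
  rw [normT, mapC_smul, mapC_T, normT]
  push_cast
  rfl

variable [Fintype W]

theorem mapC_equivFun_symm (q : ℝ) (u : W → ℝ) :
    mapC cs q ((basisT cs q).equivFun.symm u) = ∑ y, (u y : ℂ) • T cs (q : ℂ) y := by
  rw [Module.Basis.equivFun_symm_apply, map_sum]
  refine Finset.sum_congr rfl fun y _ => ?_
  rw [mapC_smul]
  congr 1
  exact mapC_T cs q y

/-- The complex Hecke algebras with parameter `q ≥ 1` are isomorphic to the group algebra, by
isomorphisms which depend continuously on `q`. -/
theorem exists_algEquiv_family :
    ∃ (g : ∀ q : Set.Ici (1 : ℝ), MonoidAlgebra ℂ W ≃ₐ[ℂ] HeckeAlgebra cs ((q : ℝ) : ℂ))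
      (γ η : W → W → Set.Ici (1 : ℝ) → ℂ),
      (∀ y w, Continuous (γ y w)) ∧ (∀ y w, Continuous (η y w)) ∧
      (∀ q w, g q (MonoidAlgebra.of ℂ W w) = ∑ y, γ y w q • T cs ((q : ℝ) : ℂ) y) ∧
      (∀ q w, (g q).symm (T cs ((q : ℝ) : ℂ) w) = ∑ y, η y w q • MonoidAlgebra.of ℂ W y) ∧
      ∀ w, g ⟨1, Set.self_mem_Ici⟩ (MonoidAlgebra.of ℂ W w) = T cs ((1 : ℝ) : ℂ) w := by
  classical
  obtain ⟨G, H, hG, hH, hG1, hH1, h⟩ := exists_real_trivialization cs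
  have eT : ∀ (q : ℝ) (w : W), (basisT cs q).equivFun (T cs q w) = Pi.single w 1 := by
    intro q w
    ext y
    rw [Module.Basis.equivFun_apply, repr_T, Pi.single_apply]
    simp only [eq_comm]
  have hmul : ∀ q, 1 ≤ q → ∀ x y : W,
      (basisT cs q).equivFun.symm (G q (Pi.single (x * y) 1)) =
        (basisT cs q).equivFun.symm (G q (Pi.single x 1)) *
          (basisT cs q).equivFun.symm (G q (Pi.single y 1)) := by
    intro q hq x y
    have := (h q hq).2.2 (T cs 1 x) (T cs 1 y)
    rwa [T_mul_T_of_eq_one cs 1 rfl, eT, eT, eT] at this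
  -- A multiplicative surjection carries the unit to a left unit, hence to `1`.
  have hone : ∀ q, 1 ≤ q → (basisT cs q).equivFun.symm (G q (Pi.single 1 1)) = 1 := by
    intro q hq
    have h1 : ∀ a : HeckeAlgebra cs q,
        (basisT cs q).equivFun.symm (G q (Pi.single 1 1)) * a = a := by
      intro a
      have h2 := (h q hq).2.2 1
        ((basisT cs (1 : ℝ)).equivFun.symm (H q ((basisT cs q).equivFun a)))
      have h3 : G q (H q ((basisT cs q).equivFun a)) = (basisT cs q).equivFun a := by
        rw [← mul_apply_eq_comp, (h q hq).2.1, one_apply_eq_self]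
      rw [one_mul, LinearEquiv.apply_symm_apply, h3, LinearEquiv.symm_apply_apply, one_def,
        eT] at h2
      exact h2.symm
    simpa using h1 1
  let φ : ∀ q : Set.Ici (1 : ℝ), W →* HeckeAlgebra cs ((q : ℝ) : ℂ) := fun q =>
    { toFun := fun w => mapC cs q ((basisT cs (q : ℝ)).equivFun.symm (G q (Pi.single w 1)))
      map_one' := by rw [hone q q.2, map_one]
      map_mul' := fun x y => by rw [hmul q q.2, _root_.map_mul] }
  have hφ : ∀ q w, φ q w = ∑ y, ((G q (Pi.single w 1) y : ℝ) : ℂ) • T cs ((q : ℝ) : ℂ) y :=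
    fun q w => mapC_equivFun_symm cs q _
  let f : ∀ q : Set.Ici (1 : ℝ), MonoidAlgebra ℂ W →ₐ[ℂ] HeckeAlgebra cs ((q : ℝ) : ℂ) := fun q =>
    MonoidAlgebra.lift ℂ _ W (φ q)
  have hf : ∀ q w, f q (MonoidAlgebra.of ℂ W w) =
      ∑ y, ((G q (Pi.single w 1) y : ℝ) : ℂ) • T cs ((q : ℝ) : ℂ) y := by
    intro q w
    rw [← hφ]
    simp [f]
  let k : ∀ q : Set.Ici (1 : ℝ), HeckeAlgebra cs ((q : ℝ) : ℂ) →ₗ[ℂ] MonoidAlgebra ℂ W := fun q =>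
    (basisT cs ((q : ℝ) : ℂ)).constr ℂ fun w =>
      ∑ y, ((H q (Pi.single w 1) y : ℝ) : ℂ) • MonoidAlgebra.of ℂ W y
  have hk : ∀ q w, k q (T cs ((q : ℝ) : ℂ) w) =
      ∑ y, ((H q (Pi.single w 1) y : ℝ) : ℂ) • MonoidAlgebra.of ℂ W y := by
    intro q w
    simp only [k]
    rw [T, Module.Basis.constr_basis]
  -- The operator identity in matrix entries, cast to `ℂ`; used with `H G = 1` and `G H = 1` to see
  -- that `k` inverts `f`.
  have hcomp : ∀ (P Q : (W → ℝ) →L[ℝ] (W → ℝ)), P * Q = 1 → ∀ w u : W,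
      ∑ y, ((Q (Pi.single w 1) y : ℝ) : ℂ) * ((P (Pi.single y 1) u : ℝ) : ℂ) =
        if u = w then 1 else 0 := by
    intro P Q hPQ w u
    have h1 : P (Q (Pi.single w 1)) = Pi.single w 1 := by
      rw [← mul_apply_eq_comp, hPQ, one_apply_eq_self]
    have h2 : Q (Pi.single w 1) = ∑ y, Q (Pi.single w 1) y • (Pi.single y 1 : W → ℝ) := by
      ext z
      simp [Finset.sum_apply, Pi.single_apply]
    rw [h2, map_sum] at h1
    have h3 := congrFun h1 u
    simp only [map_smul, Finset.sum_apply, Pi.smul_apply, smul_eq_mul, Pi.single_apply] at h3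
    rw [← Complex.ofReal_one, ← Complex.ofReal_zero, ← apply_ite Complex.ofReal, ← h3]
    push_cast
    rfl
  have hl : ∀ q x, k q (f q x) = x := by
    intro q x
    suffices hs : k q ∘ₗ (f q).toLinearMap = LinearMap.id from LinearMap.congr_fun hs x
    refine MonoidAlgebra.lhom_ext' fun w => LinearMap.ext_ring ?_
    change k q (f q (MonoidAlgebra.of ℂ W w)) = MonoidAlgebra.of ℂ W w
    simp only [hf, map_sum, map_smul, hk, Finset.smul_sum, smul_smul]
    rw [Finset.sum_comm]
    simp only [← Finset.sum_smul, hcomp _ _ (h q q.2).1, ite_smul, one_smul, zero_smul,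
      Finset.sum_ite_eq', Finset.mem_univ, if_true]
  have hr : ∀ q x, f q (k q x) = x := by
    intro q x
    suffices hs : (f q).toLinearMap ∘ₗ k q = LinearMap.id from LinearMap.congr_fun hs x
    refine linearMap_ext cs _ fun w => ?_
    change f q (k q (T cs _ w)) = T cs _ w
    simp only [hk, map_sum, map_smul, hf, Finset.smul_sum, smul_smul]
    rw [Finset.sum_comm]
    simp only [← Finset.sum_smul, hcomp _ _ (h q q.2).2.1, ite_smul, one_smul, zero_smul,
      Finset.sum_ite_eq', Finset.mem_univ, if_true]
  have hcont : ∀ P : ℝ → (W → ℝ) →L[ℝ] (W → ℝ), Continuous P → ∀ y w,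
      Continuous fun q : Set.Ici (1 : ℝ) => ((P q (Pi.single w 1) y : ℝ) : ℂ) := by
    intro P hP y w
    have h1 : Continuous fun q : ℝ => P q (Pi.single w 1) := hP.clm_apply continuous_const
    exact Complex.continuous_ofReal.comp (((continuous_apply y).comp h1).comp continuous_subtype_val)
  refine ⟨fun q => { f q with
    invFun := k q
    left_inv := hl q
    right_inv := hr q }, fun y w q => ((G q (Pi.single w 1) y : ℝ) : ℂ),
    fun y w q => ((H q (Pi.single w 1) y : ℝ) : ℂ), hcont G hG, hcont H hH, hf, hk, fun w => ?_⟩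
  refine (hf ⟨1, Set.self_mem_Ici⟩ w).trans ?_
  simp [hG1, Pi.single_apply]

end Complexify

end HeckeAlgebra

/-! ### Irreducible characters and central elements -/

section IrreducibleCharacters

/-- Schur's lemma. -/
theorem exists_eq_smul_one_of_commute {A V : Type*} [Ring A] [Algebra ℂ A] [AddCommGroup V]
    [Module ℂ V] [FiniteDimensional ℂ V] [Nontrivial V] (ρ : A →ₐ[ℂ] Module.End ℂ V)
    (hρ : ∀ p : Submodule ℂ V, (∀ a, ∀ v ∈ p, ρ a v ∈ p) → p = ⊥ ∨ p = ⊤)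
    (f : Module.End ℂ V) (hf : ∀ a, f * ρ a = ρ a * f) : ∃ c : ℂ, f = c • 1 := by
  obtain ⟨c, hc⟩ := Module.End.exists_eigenvalue f
  refine ⟨c, ?_⟩
  have h := (hρ (f.eigenspace c) fun a v hv => by
    rw [Module.End.mem_eigenspace_iff] at hv ⊢
    rw [← Module.End.mul_apply, hf, Module.End.mul_apply, hv, map_smul]).resolve_left hc
  ext v
  have hv : v ∈ f.eigenspace c := h ▸ Submodule.mem_top
  rw [Module.End.mem_eigenspace_iff] at hv
  simpa using hv

theorem IsIrrCharacter.mul_comm {A : Type*} [Ring A] [Algebra ℂ A] {χ : A →ₗ[ℂ] ℂ}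
    (h : IsIrrCharacter A χ) (a b : A) : χ (a * b) = χ (b * a) := by
  obtain ⟨d, ρ, _, _, hχ⟩ := h
  rw [hχ, hχ, map_mul ρ, map_mul ρ, LinearMap.trace_mul_comm]

theorem IsIrrCharacter.comp {A B : Type*} [Ring A] [Algebra ℂ A] [Ring B] [Algebra ℂ B]
    {χ : A →ₗ[ℂ] ℂ} (h : IsIrrCharacter A χ) (e : B ≃ₐ[ℂ] A) :
    IsIrrCharacter B (χ ∘ₗ e.toLinearMap) := by
  obtain ⟨d, ρ, hd, hρ, hχ⟩ := h
  refine ⟨d, ρ.comp e.toAlgHom, hd, fun p hp => hρ p fun a v hv => ?_, fun b => hχ (e b)⟩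
  have := hp (e.symm a) v hv
  simpa using this

/-- Transport of irreducible characters along an isomorphism of algebras. -/
noncomputable def IrrChar.congr {A B : Type*} [Ring A] [Algebra ℂ A] [Ring B] [Algebra ℂ B]
    (e : A ≃ₐ[ℂ] B) : IrrChar A ≃ IrrChar B where
  toFun χ := ⟨χ.1 ∘ₗ e.symm.toLinearMap, χ.2.comp e.symm⟩
  invFun χ := ⟨χ.1 ∘ₗ e.toLinearMap, χ.2.comp e⟩
  left_inv χ := Subtype.ext (LinearMap.ext fun a => congrArg χ.1 (e.symm_apply_apply a))
  right_inv χ := Subtype.ext (LinearMap.ext fun a => congrArg χ.1 (e.apply_symm_apply a))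

/-- A central element on which all irreducible characters vanish acts as zero on all simple
modules. -/
theorem smul_eq_zero_of_irrChar {A : Type*} [Ring A] [Algebra ℂ A] {z : A}
    (hz : ∀ a, z * a = a * z) (hχ : ∀ χ : IrrChar A, χ.1 z = 0) {S : Type*} [AddCommGroup S]
    [Module A S] [Module ℂ S] [IsScalarTower ℂ A S] [FiniteDimensional ℂ S] [IsSimpleModule A S]
    (v : S) : z • v = 0 := by
  have hnt : Nontrivial S := IsSimpleModule.nontrivial A S
  let σ : A →ₐ[ℂ] Module.End ℂ S := Algebra.lsmul ℂ ℂ S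
  have hσ : ∀ p : Submodule ℂ S, (∀ a, ∀ v ∈ p, σ a v ∈ p) → p = ⊥ ∨ p = ⊤ := by
    intro p hp
    let p' : Submodule A S := { p with smul_mem' := hp }
    rcases eq_bot_or_eq_top p' with h | h
    · left
      ext v
      have : v ∈ p' ↔ v ∈ (⊥ : Submodule A S) := by rw [h]
      exact this
    · right
      ext v
      have : v ∈ p' ↔ v ∈ (⊤ : Submodule A S) := by rw [h]
      exact this
  -- By Schur `z` acts as a scalar `c`, whose trace `c · dim S` vanishes by assumption.
  obtain ⟨c, hc⟩ := exists_eq_smul_one_of_commute σ hσ (σ z) fun a => by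
    rw [← map_mul, hz, map_mul]
  let e : S ≃ₗ[ℂ] (Fin (Module.finrank ℂ S) → ℂ) := (Module.finBasis ℂ S).equivFun
  let χ : A →ₗ[ℂ] ℂ := LinearMap.trace ℂ S ∘ₗ σ.toLinearMap
  have hirr : IsIrrCharacter A χ := by
    refine ⟨Module.finrank ℂ S, ((e.conjAlgEquiv ℂ).toAlgHom).comp σ, Module.finrank_pos, ?_, ?_⟩
    · intro p hp
      rcases hσ (p.comap e.toLinearMap) (fun a v hv => by
        have := hp a (e v) hv
        simpa [LinearEquiv.conjAlgEquiv_apply] using this) with h | h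
      · left
        rw [← Submodule.map_comap_eq_of_surjective (f := e.toLinearMap) e.surjective p, h,
          Submodule.map_bot]
      · right
        rw [← Submodule.map_comap_eq_of_surjective (f := e.toLinearMap) e.surjective p, h,
          Submodule.map_top, LinearMap.range_eq_top]
        exact e.surjective
    · intro a
      exact (LinearMap.trace_conj' (σ a) e).symm
  have h0 : LinearMap.trace ℂ S (σ z) = 0 := hχ ⟨χ, hirr⟩
  rw [hc, map_smul, LinearMap.trace_one, smul_eq_mul] at h0
  have hc0 : c = 0 := by
    refine (mul_eq_zero.1 h0).resolve_right ?_
    exact_mod_cast (Module.finrank_pos (R := ℂ) (M := S)).ne'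
  have : σ z v = 0 := by rw [hc, hc0, zero_smul, LinearMap.zero_apply]
  exact this

/-- Such a `z` kills every simple quotient of `A`, so it lies in all maximal left ideals and thus in
the Jacobson radical, which is zero. -/
theorem eq_zero_of_irrChar {A : Type*} [Ring A] [Algebra ℂ A] [FiniteDimensional ℂ A]
    [IsSemisimpleRing A] {z : A}
    (hz : ∀ a, z * a = a * z) (hχ : ∀ χ : IrrChar A, χ.1 z = 0) : z = 0 := by
  have h : z ∈ Ring.jacobson A := by
    rw [Ring.jacobson_eq_sInf_isMaximal, Submodule.mem_sInf]
    intro I hI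
    have : IsSimpleModule A (A ⧸ I) := isSimpleModule_iff_isCoatom.2 (Ideal.isMaximal_def.1 hI)
    have : FiniteDimensional ℂ (A ⧸ I) :=
      Module.Finite.of_surjective ((Submodule.mkQ I).restrictScalars ℂ) (Submodule.mkQ_surjective I)
    have h1 := smul_eq_zero_of_irrChar hz hχ (Submodule.Quotient.mk (p := I) (1 : A))
    rwa [← Submodule.Quotient.mk_smul, smul_eq_mul, mul_one, Submodule.Quotient.mk_eq_zero] at h1
  rwa [IsSemisimpleRing.jacobson_eq_bot, Submodule.mem_bot] at h

end IrreducibleCharacters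

/-! ### Trace functions and the regular character of a finite group -/

section GroupCharacters

variable {W : Type*} [Group W]

theorem GroupIrr.val_conj (χ : GroupIrr W) (u v : W) : χ.val (u * v * u⁻¹) = χ.val v := by
  rw [GroupIrr.val, map_mul, χ.2.mul_comm, ← map_mul]
  simp [GroupIrr.val]

theorem GroupIrr.ext_val {χ ψ : GroupIrr W} (h : ∀ g, χ.val g = ψ.val g) : χ = ψ :=
  Subtype.ext (MonoidAlgebra.lhom_ext' fun g => LinearMap.ext_ring (h g))

variable [Fintype W]

theorem MonoidAlgebra.eq_sum_of (a : MonoidAlgebra ℂ W) :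
    a = ∑ g, a.coeff g • MonoidAlgebra.of ℂ W g := by
  conv_lhs => rw [← (MonoidAlgebra.basis W ℂ).sum_repr a]
  rfl

theorem GroupIrr.coeff_eq {f : MonoidAlgebra ℂ W →ₗ[ℂ] ℂ} {t : GroupIrr W → ℂ}
    (h : f = ∑ χ, t χ • χ.1) (ψ : GroupIrr W) :
    t ψ = (Nat.card W : ℂ)⁻¹ * ∑ g : W, f (MonoidAlgebra.of ℂ W g) * ψ.val g⁻¹ := by
  have : (Nat.card W : ℂ)⁻¹ * ∑ g : W, f (MonoidAlgebra.of ℂ W g) * ψ.val g⁻¹ =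
      ∑ χ, t χ * ((Nat.card W : ℂ)⁻¹ * ∑ g : W, χ.val g * ψ.val g⁻¹) := by
    simp only [h, LinearMap.sum_apply, LinearMap.smul_apply, Finset.mul_sum, Finset.sum_mul,
      smul_eq_mul]
    rw [Finset.sum_comm]
    refine Finset.sum_congr rfl fun χ _ => Finset.sum_congr rfl fun g _ => ?_
    simp only [GroupIrr.val]
    ring
  rw [this]
  simp only [GroupIrr.orthonormal]
  simp

/-- Trace functions on the group algebra are combinations of irreducible characters. -/
theorem GroupIrr.eq_sum (f : MonoidAlgebra ℂ W →ₗ[ℂ] ℂ) (hf : ∀ a b, f (a * b) = f (b * a)) :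
    f = ∑ χ : GroupIrr W, ((Nat.card W : ℂ)⁻¹ *
      ∑ g : W, f (MonoidAlgebra.of ℂ W g) * χ.val g⁻¹) • χ.1 := by
  classical
  set t : GroupIrr W → ℂ := fun χ => (Nat.card W : ℂ)⁻¹ *
      ∑ g : W, f (MonoidAlgebra.of ℂ W g) * χ.val g⁻¹ with ht
  -- The remainder `f'` is a class function orthogonal to every irreducible character. The central
  -- element with coefficients `f'(g⁻¹)` then has vanishing characters, so it is zero.
  let f' : MonoidAlgebra ℂ W →ₗ[ℂ] ℂ := f - ∑ χ, t χ • χ.1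
  have hf' : ∀ a b, f' (a * b) = f' (b * a) := by
    intro a b
    simp only [f', LinearMap.sub_apply, LinearMap.sum_apply, LinearMap.smul_apply, hf a b]
    rw [Finset.sum_congr rfl fun χ _ => by rw [χ.2.mul_comm a b]]
  let F : W → ℂ := fun g => f' (MonoidAlgebra.of ℂ W g)
  have hF : ∀ u v, F (u * v) = F (v * u) := by
    intro u v
    simp only [F, map_mul, hf']
  have hort : ∀ ψ : GroupIrr W, ∑ g, F g * ψ.val g⁻¹ = 0 := by
    intro ψ
    have hc : (Nat.card W : ℂ) ≠ 0 := Nat.cast_ne_zero.2 Nat.card_pos.ne'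
    have h1 := GroupIrr.coeff_eq (f := ∑ χ, t χ • χ.1) rfl ψ
    have h2 : ∑ g, F g * ψ.val g⁻¹ = ∑ g : W, f (MonoidAlgebra.of ℂ W g) * ψ.val g⁻¹ -
        ∑ g : W, (∑ χ, t χ • χ.1) (MonoidAlgebra.of ℂ W g) * ψ.val g⁻¹ := by
      rw [← Finset.sum_sub_distrib]
      refine Finset.sum_congr rfl fun g _ => ?_
      simp only [F, f', LinearMap.sub_apply]
      ring
    have h3 := mul_left_cancel₀ (inv_ne_zero hc) ((congrFun ht ψ).symm.trans h1)
    rw [h2, h3, sub_self]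
  let z : MonoidAlgebra ℂ W := ∑ g, F g⁻¹ • MonoidAlgebra.of ℂ W g
  have hz : ∀ a, z * a = a * z := by
    intro a
    rw [MonoidAlgebra.eq_sum_of a, Finset.mul_sum, Finset.sum_mul]
    refine Finset.sum_congr rfl fun u _ => ?_
    rw [mul_smul_comm, smul_mul_assoc]
    congr 1
    simp only [z, Finset.mul_sum, Finset.sum_mul, mul_smul_comm, smul_mul_assoc, ← map_mul]
    refine Fintype.sum_equiv (MulAut.conj u⁻¹).toEquiv _ _ fun g => ?_
    have e1 : F (u⁻¹ * g * u)⁻¹ = F g⁻¹ := by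
      rw [mul_inv_rev, hF, mul_inv_rev, inv_inv, mul_inv_cancel_right]
    have e2 : u * (u⁻¹ * g * u) = g * u := by group
    simp only [MulEquiv.toEquiv_eq_coe, MulEquiv.coe_toEquiv, MulAut.conj_apply, inv_inv, e1, e2]
  have hz0 : z = 0 := by
    have hne : NeZero (Nat.card W : ℂ) := ⟨Nat.cast_ne_zero.2 Nat.card_pos.ne'⟩
    have : FiniteDimensional ℂ (MonoidAlgebra ℂ W) :=
      Module.Finite.of_basis (MonoidAlgebra.basis W ℂ)
    refine eq_zero_of_irrChar hz fun ψ => ?_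
    rw [map_sum, ← hort ψ, ← Equiv.sum_comp (Equiv.inv W)]
    refine Finset.sum_congr rfl fun g _ => ?_
    rw [map_smul, smul_eq_mul]
    simp [GroupIrr.val]
  have hF0 : ∀ g, F g = 0 := by
    intro g
    have h1 := congrArg (fun a => (MonoidAlgebra.basis W ℂ).repr a g⁻¹) hz0
    have h2 : ∀ g, MonoidAlgebra.of ℂ W g = MonoidAlgebra.basis W ℂ g := fun g => rfl
    simp only [z, h2, map_sum, map_smul, Module.Basis.repr_self, Finsupp.finsetSum_apply,
      Finsupp.smul_apply, Finsupp.single_apply, map_zero, Finsupp.zero_apply, smul_eq_mul,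
      mul_ite, mul_one, mul_zero, Finset.sum_ite_eq', Finset.mem_univ, if_true, inv_inv] at h1
    exact h1
  have hf0 : f' = 0 :=
    MonoidAlgebra.lhom_ext' fun g => LinearMap.ext_ring (hF0 g)
  exact sub_eq_zero.1 hf0

/-- The character of the regular representation. -/
theorem GroupIrr.trace_mulLeft (a : MonoidAlgebra ℂ W) :
    LinearMap.trace ℂ (MonoidAlgebra ℂ W) (LinearMap.mulLeft ℂ a) =
      ∑ χ : GroupIrr W, χ.dim * χ.1 a := by
  classical
  let f : MonoidAlgebra ℂ W →ₗ[ℂ] ℂ :=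
    LinearMap.trace ℂ (MonoidAlgebra ℂ W) ∘ₗ LinearMap.mul ℂ (MonoidAlgebra ℂ W)
  have hf : ∀ a, f a = LinearMap.trace ℂ (MonoidAlgebra ℂ W) (LinearMap.mulLeft ℂ a) := fun _ => rfl
  have hcomm : ∀ a b, f (a * b) = f (b * a) := by
    intro a b
    rw [hf, hf, LinearMap.mulLeft_mul, LinearMap.mulLeft_mul, ← Module.End.mul_eq_comp,
      LinearMap.trace_mul_comm, Module.End.mul_eq_comp]
  have hval : ∀ g : W, f (MonoidAlgebra.of ℂ W g) = if g = 1 then (Nat.card W : ℂ) else 0 := by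
    intro g
    rw [hf, LinearMap.trace_eq_matrix_trace ℂ (MonoidAlgebra.basis W ℂ), Matrix.trace]
    have : ∀ x, (LinearMap.toMatrix (MonoidAlgebra.basis W ℂ) (MonoidAlgebra.basis W ℂ)
        (LinearMap.mulLeft ℂ (MonoidAlgebra.of ℂ W g))).diag x = if g = 1 then 1 else 0 := by
      intro x
      rw [Matrix.diag_apply, LinearMap.toMatrix_apply, LinearMap.mulLeft_apply]
      have : MonoidAlgebra.of ℂ W g * MonoidAlgebra.basis W ℂ x = MonoidAlgebra.basis W ℂ (g * x) :=
        (map_mul (MonoidAlgebra.of ℂ W) g x).symm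
      rw [this, Module.Basis.repr_self, Finsupp.single_apply]
      simp
    rw [Finset.sum_congr rfl fun x _ => this x]
    split_ifs <;> simp
  have h := GroupIrr.eq_sum f hcomm
  have hc : (Nat.card W : ℂ) ≠ 0 := Nat.cast_ne_zero.2 Nat.card_pos.ne'
  rw [← hf, h, LinearMap.sum_apply]
  refine Finset.sum_congr rfl fun χ _ => ?_
  rw [LinearMap.smul_apply, smul_eq_mul]
  congr 1
  simp only [hval, ite_mul, zero_mul, Finset.sum_ite_eq', Finset.mem_univ, if_true, inv_one]
  rw [inv_mul_cancel_left₀ hc, GroupIrr.dim]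

end GroupCharacters

/-- A continuous function with finitely many values on a preconnected space is constant. -/
theorem Continuous.eq_of_finite_values {X Y : Type*} [TopologicalSpace X] [PreconnectedSpace X]
    [TopologicalSpace Y] [T1Space Y] {f : X → Y} (hf : Continuous f) {s : Set Y} (hs : s.Finite)
    (h : ∀ x, f x ∈ s) (x y : X) : f x = f y := by
  -- The complement of the fibre is the preimage of the other finitely many values, a closed set.
  have h1 : IsClopen (f ⁻¹' {f y}) := by
    refine ⟨isClosed_singleton.preimage hf, ?_⟩
    have : f ⁻¹' {f y} = (f ⁻¹' (s \ {f y}))ᶜ := by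
      ext z
      simp [h z]
    rw [this]
    exact ((hs.subset Set.sdiff_subset).isClosed.preimage hf).isOpen_compl
  have h2 := h1.eq_univ ⟨y, rfl⟩
  have : x ∈ f ⁻¹' {f y} := h2 ▸ Set.mem_univ x
  exact this

/-- An operator with the quadratic relation of the Hecke algebra has eigenvalues `q` and `-1`. -/
theorem exists_trace_det_of_quadratic {V : Type*} [AddCommGroup V] [Module ℂ V]
    [FiniteDimensional ℂ V] {q : ℂ} (hq : q + 1 ≠ 0) {f : Module.End ℂ V}
    (hf : (f - q • 1) * (f + 1) = 0) :
    ∃ m : ℕ, m ≤ Module.finrank ℂ V ∧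
      LinearMap.trace ℂ V f = (q + 1) * m - Module.finrank ℂ V ∧
      LinearMap.det f ^ 2 = q ^ (2 * m) := by
  -- The projection onto the `q`-eigenspace along the `-1`-eigenspace; its rank is `m`. Squaring the
  -- determinant removes the sign from the eigenvalue `-1`.
  let e : Module.End ℂ V := (q + 1)⁻¹ • (f + 1)
  have hfe : f = (q + 1) • e - 1 := by
    simp only [e, smul_smul, mul_inv_cancel₀ hq, one_smul, add_sub_cancel_right]
  have he : IsIdempotentElem e := by
    have h1 : (f + 1) * (f + 1) = (q + 1) • (f + 1) := by
      rw [← sub_eq_zero, ← hf, sub_mul, add_mul, add_smul, smul_mul_assoc, one_mul, one_smul]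
      abel
    change e * e = e
    simp only [e, smul_mul_smul_comm, h1, smul_smul]
    congr 1
    field_simp
  have hp := LinearMap.IsIdempotentElem.isProj_range e he
  refine ⟨Module.finrank ℂ (LinearMap.range e), Submodule.finrank_le _, ?_, ?_⟩
  · conv_lhs => rw [hfe]
    rw [map_sub, map_smul, hp.trace, LinearMap.trace_one, smul_eq_mul]
  · let E := (LinearMap.range e).prodEquivOfIsCompl (LinearMap.ker e) hp.isCompl
    have h2 : f = E.conj (LinearMap.prodMap (q • LinearMap.id) (-LinearMap.id)) := by
      have h3 : f = E.conj ((q + 1) • LinearMap.prodMap LinearMap.id 0 - LinearMap.id) := by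
        rw [map_sub, map_smul, ← hp.eq_conj_prodMap, LinearEquiv.conj_id]
        exact hfe
      rw [h3]
      congr 1
      ext x <;> simp [add_smul]
    rw [h2, LinearEquiv.conj_apply, LinearMap.comp_assoc, LinearMap.det_conj, LinearMap.det_prodMap, LinearMap.det_smul, ← neg_one_smul ℂ,
      LinearMap.det_smul, LinearMap.det_id, LinearMap.det_id, mul_one, mul_one, mul_pow, ← pow_mul,
      ← pow_mul, mul_comm 2]
    simp

theorem HeckeAlgebra.isIrrCharacter_index {B W : Type*} [Group W] {M : CoxeterMatrix B}
    (cs : CoxeterSystem M W) (q : ℂ) :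
    IsIrrCharacter (HeckeAlgebra cs q) (index cs q).toLinearMap := by
  refine ⟨1, (Algebra.ofId ℂ (Module.End ℂ (Fin 1 → ℂ))).comp (index cs q), one_pos, ?_, ?_⟩
  · intro p _
    have h : IsSimpleOrder (Submodule ℂ (Fin 1 → ℂ)) := by
      have : IsSimpleModule ℂ (Fin 1 → ℂ) :=
        isSimpleModule_iff_finrank_eq_one.2 (by simp)
      exact (isSimpleModule_iff ℂ _).1 this
    exact h.eq_bot_or_eq_top p
  · intro a
    simp [Algebra.ofId_apply, Algebra.algebraMap_eq_smul_one]

/-- Isomorphisms between the group algebra of `W` and the Hecke algebras with parameter `q ≥ 1`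
which depend continuously on `q`. -/
structure HeckeTrivialization {B W : Type*} [Group W] [Fintype W] {M : CoxeterMatrix B}
    (cs : CoxeterSystem M W) where
  iso : ∀ q : Set.Ici (1 : ℝ), MonoidAlgebra ℂ W ≃ₐ[ℂ] HeckeAlgebra cs ((q : ℝ) : ℂ)
  coeff : W → W → Set.Ici (1 : ℝ) → ℂ
  coeffInv : W → W → Set.Ici (1 : ℝ) → ℂ
  continuous_coeff : ∀ y w, Continuous (coeff y w)
  continuous_coeffInv : ∀ y w, Continuous (coeffInv y w)
  iso_of : ∀ q w, iso q (MonoidAlgebra.of ℂ W w) = ∑ y, coeff y w q • T cs ((q : ℝ) : ℂ) y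
  iso_symm_T : ∀ q w,
    (iso q).symm (T cs ((q : ℝ) : ℂ) w) = ∑ y, coeffInv y w q • MonoidAlgebra.of ℂ W y
  iso_one : ∀ w, iso ⟨1, Set.self_mem_Ici⟩ (MonoidAlgebra.of ℂ W w) = T cs ((1 : ℝ) : ℂ) w

/-! ### The correspondence of characters: existence and uniqueness -/

namespace HeckeTrivialization

variable {B W : Type*} [Group W] [Fintype W] {M : CoxeterMatrix B} {cs : CoxeterSystem M W}

theorem nonempty (cs : CoxeterSystem M W) : Nonempty (HeckeTrivialization cs) := by
  obtain ⟨g, γ, η, hγ, hη, h1, h2, h3⟩ := exists_algEquiv_family cs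
  exact ⟨⟨g, γ, η, hγ, hη, h1, h2, h3⟩⟩

instance : PreconnectedSpace (Set.Ici (1 : ℝ)) :=
  isPreconnected_iff_preconnectedSpace.1 isPreconnected_Ici

variable (F : HeckeTrivialization cs)

theorem iso_symm_one (w : W) : (F.iso ⟨1, Set.self_mem_Ici⟩).symm (T cs ((1 : ℝ) : ℂ) w) =
    MonoidAlgebra.of ℂ W w := by
  rw [AlgEquiv.symm_apply_eq, F.iso_one]

/-- The correspondence of irreducible characters given by the isomorphisms. -/
noncomputable def correspondence : HeckeCorrespondence cs := fun q => IrrChar.congr (F.iso q)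

theorem correspondence_apply (q : Set.Ici (1 : ℝ)) (χ : GroupIrr W)
    (a : HeckeAlgebra cs ((q : ℝ) : ℂ)) :
    (F.correspondence q χ).1 a = χ.1 ((F.iso q).symm a) := rfl

theorem correspondence_T (q : Set.Ici (1 : ℝ)) (χ : GroupIrr W) (w : W) :
    (F.correspondence q χ).1 (T cs ((q : ℝ) : ℂ) w) = ∑ y, F.coeffInv y w q * χ.val y := by
  rw [correspondence_apply, F.iso_symm_T, map_sum]
  exact Finset.sum_congr rfl fun y _ => by rw [map_smul, smul_eq_mul, GroupIrr.val]

theorem continuous_correspondence_T (χ : GroupIrr W) (w : W) :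
    Continuous fun q : Set.Ici (1 : ℝ) => (F.correspondence q χ).1 (T cs ((q : ℝ) : ℂ) w) := by
  simp only [correspondence_T]
  exact continuous_finsetSum _ fun y _ => (F.continuous_coeffInv y w).mul continuous_const

theorem correspondence_isSpecialization : F.correspondence.IsSpecialization := by
  refine fun χ w => ⟨F.continuous_correspondence_T χ w, ?_⟩
  rw [correspondence_apply]
  exact congrArg χ.1 (F.iso_symm_one w)

/-- A continuous family of irreducible characters is determined by its value at `q = 1`. -/
theorem eq_correspondence {ξ : ∀ q : Set.Ici (1 : ℝ), IrrChar (HeckeAlgebra cs ((q : ℝ) : ℂ))}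
    (hξ : ∀ w, Continuous fun q : Set.Ici (1 : ℝ) => (ξ q).1 (T cs ((q : ℝ) : ℂ) w))
    {χ : GroupIrr W} (h1 : ∀ w, (ξ ⟨1, Set.self_mem_Ici⟩).1 (T cs ((1 : ℝ) : ℂ) w) = χ.val w)
    (q : Set.Ici (1 : ℝ)) : ξ q = F.correspondence q χ := by
  let η : Set.Ici (1 : ℝ) → GroupIrr W := fun q => (F.correspondence q).symm (ξ q)
  have hη : ∀ q w, (η q).val w = ∑ y, F.coeff y w q * (ξ q).1 (T cs ((q : ℝ) : ℂ) y) := by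
    intro q w
    have : (η q).val w = (ξ q).1 (F.iso q (MonoidAlgebra.of ℂ W w)) := rfl
    rw [this, F.iso_of, map_sum]
    exact Finset.sum_congr rfl fun y _ => by rw [map_smul, smul_eq_mul]
  -- `η q` is `ξ q` pulled back to the group. By orthonormality its pairing with `χ` is `0` or `1`,
  -- and it equals `1` at `q = 1`.
  have hc : Continuous fun q => (Nat.card W : ℂ)⁻¹ * ∑ g : W, (η q).val g * χ.val g⁻¹ := by
    refine continuous_const.mul (continuous_finsetSum _ fun g _ => Continuous.mul ?_
      continuous_const)
    simp only [hη]
    exact continuous_finsetSum _ fun y _ => (F.continuous_coeff y g).mul (hξ y)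
  have hη1 : η ⟨1, Set.self_mem_Ici⟩ = χ := by
    refine GroupIrr.ext_val fun w => ?_
    rw [← h1]
    exact congrArg (ξ ⟨1, Set.self_mem_Ici⟩).1 (F.iso_one w)
  simp only [GroupIrr.orthonormal] at hc
  have hconst := hc.eq_of_finite_values (s := {0, 1}) (by simp)
    (fun q => by split_ifs <;> simp) q ⟨1, Set.self_mem_Ici⟩
  rw [hη1, if_pos rfl] at hconst
  have hq : η q = χ := by
    by_contra h
    rw [if_neg h] at hconst
    exact zero_ne_one hconst
  exact ((F.correspondence q).symm_apply_eq).1 hq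

theorem eq_correspondence_of_isSpecialization {X : HeckeCorrespondence cs}
    (hX : X.IsSpecialization) : X = F.correspondence := by
  funext q
  ext1 χ
  exact F.eq_correspondence (ξ := fun q => X q χ) (fun w => (hX χ w).1) (fun w => (hX χ w).2) q

theorem existsUnique_isSpecialization (cs : CoxeterSystem M W) :
    ∃! X : HeckeCorrespondence cs, X.IsSpecialization := by
  obtain ⟨F⟩ := nonempty cs
  exact ⟨F.correspondence, F.correspondence_isSpecialization,
    fun _ hX => F.eq_correspondence_of_isSpecialization hX⟩

/-- The trivial character corresponds to the index representation. -/
theorem correspondence_trivial (q : Set.Ici (1 : ℝ)) (a : HeckeAlgebra cs ((q : ℝ) : ℂ)) :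
    (F.correspondence q (GroupIrr.trivial W)).1 a = index cs _ a := by
  have := F.eq_correspondence (χ := GroupIrr.trivial W)
    (ξ := fun q => ⟨(index cs _).toLinearMap, isIrrCharacter_index cs ((q : ℝ) : ℂ)⟩)
    (fun w => by
      simp only [AlgHom.toLinearMap_apply, index_T]
      fun_prop)
    (fun w => by
      rw [GroupIrr.trivial_val]
      simp [index_T]) q
  rw [← this]
  rfl

end HeckeTrivialization

theorem HeckeAlgebra.heckeTrace_apply {B W R : Type*} [Group W] [Fintype W] [CommRing R]
    {M : CoxeterMatrix B} (cs : CoxeterSystem M W) (q : R) (a : HeckeAlgebra cs q) :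
    heckeTrace cs q a = poincare cs q * tau cs q a := rfl

/-! ### The scalar of `T w₀ ^ 2` and the generic degrees -/

namespace HeckeTrivialization

variable {B W : Type*} [Group W] [Fintype W] {M : CoxeterMatrix B} {cs : CoxeterSystem M W}
  (F : HeckeTrivialization cs)

/-- For each simple reflection, the multiplicity of the eigenvalue `q` does not depend on `q`. -/
theorem exists_det_T_simple {d : ℕ} (χ : GroupIrr W)
    (ρ : MonoidAlgebra ℂ W →ₐ[ℂ] Module.End ℂ (Fin d → ℂ))
    (hχ : ∀ a, χ.1 a = LinearMap.trace ℂ (Fin d → ℂ) (ρ a)) (i : B) :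
    ∃ m : ℕ, (2 * m : ℂ) = χ.val (cs.simple i) + d ∧ ∀ q : Set.Ici (1 : ℝ),
      LinearMap.det (ρ ((F.iso q).symm (T cs ((q : ℝ) : ℂ) (cs.simple i)))) ^ 2 =
        ((q : ℝ) : ℂ) ^ (2 * m) := by
  have hq1 : ∀ q : Set.Ici (1 : ℝ), ((q : ℝ) : ℂ) + 1 ≠ 0 := by
    intro q h
    have h1 : (q : ℝ) + 1 = 0 := by exact_mod_cast h
    have h2 : (1 : ℝ) ≤ q := q.2
    linarith
  have h : ∀ q : Set.Ici (1 : ℝ), ∃ m : ℕ, m ≤ d ∧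
      (F.correspondence q χ).1 (T cs ((q : ℝ) : ℂ) (cs.simple i)) =
        (((q : ℝ) : ℂ) + 1) * m - d ∧
      LinearMap.det (ρ ((F.iso q).symm (T cs ((q : ℝ) : ℂ) (cs.simple i)))) ^ 2 =
        ((q : ℝ) : ℂ) ^ (2 * m) := by
    intro q
    have h1 := congrArg (fun a => ρ ((F.iso q).symm a)) (quadratic_relation cs ((q : ℝ) : ℂ) i)
    simp only [map_mul, map_sub, map_add, map_smul, map_one, map_zero] at h1
    have h2 := exists_trace_det_of_quadratic (hq1 q) h1
    rw [Module.finrank_fin_fun] at h2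
    rw [correspondence_apply, hχ]
    exact h2
  choose m hm htr hdet using h
  -- Solving the trace formula for the multiplicity shows it is continuous in `q`; as an integer
  -- between `0` and `d` it is constant.
  have hmq : ∀ q, (m q : ℂ) =
      ((F.correspondence q χ).1 (T cs ((q : ℝ) : ℂ) (cs.simple i)) + d) /
        (((q : ℝ) : ℂ) + 1) := by
    intro q
    rw [htr, sub_add_cancel, mul_div_cancel_left₀ _ (hq1 q)]
  have hcont : Continuous fun q => (m q : ℂ) := by
    simp only [hmq]
    refine ((F.continuous_correspondence_T χ _).add continuous_const).div ?_ hq1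
    fun_prop
  have hconst : ∀ q, m q = m ⟨1, Set.self_mem_Ici⟩ := by
    intro q
    have := hcont.eq_of_finite_values (s := (fun k : ℕ => (k : ℂ)) '' Set.Iic d)
      ((Set.finite_Iic d).image _) (fun q => ⟨m q, hm q, rfl⟩) q ⟨1, Set.self_mem_Ici⟩
    exact_mod_cast this
  refine ⟨m ⟨1, Set.self_mem_Ici⟩, ?_, fun q => ?_⟩
  · have h1 := htr ⟨1, Set.self_mem_Ici⟩
    have h2 := (F.correspondence_isSpecialization χ (cs.simple i)).2
    rw [h2] at h1
    rw [h1]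
    push_cast
    ring
  · rw [hdet, hconst]

theorem sum_reflection_val (cs : CoxeterSystem M W) (χ : GroupIrr W) [DecidablePred cs.IsReflection] :
    χ.1 (reflectionSum cs) = ∑ t : W with cs.IsReflection t, χ.val t := by
  rw [reflectionSum, map_sum]
  refine Finset.sum_congr ?_ fun _ _ => rfl
  ext t
  simp

theorem continuous_ofReal_cpow (a : ℂ) :
    Continuous fun q : Set.Ici (1 : ℝ) => ((q : ℝ) : ℂ) ^ a := by
  rw [continuous_iff_continuousAt]
  intro q
  have h : (1 : ℝ) ≤ q := q.2
  refine ContinuousAt.cpow (by fun_prop) continuousAt_const ?_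
  exact Complex.ofReal_mem_slitPlane.2 (by linarith)

theorem continuous_correspondence_T_sq (χ : GroupIrr W) (w : W) :
    Continuous fun q : Set.Ici (1 : ℝ) =>
      (F.correspondence q χ).1 (T cs ((q : ℝ) : ℂ) w ^ 2) := by
  have e : ∀ q : Set.Ici (1 : ℝ), (F.correspondence q χ).1 (T cs ((q : ℝ) : ℂ) w ^ 2) =
      ∑ y, ∑ u, F.coeffInv y w q * F.coeffInv u w q *
        χ.1 (MonoidAlgebra.of ℂ W y * MonoidAlgebra.of ℂ W u) := by
    intro q
    rw [correspondence_apply, map_pow, F.iso_symm_T, pow_two, Finset.sum_mul_sum]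
    simp only [smul_mul_smul_comm, map_sum, map_smul, smul_eq_mul]
  simp only [e]
  refine continuous_finsetSum _ fun y _ => continuous_finsetSum _ fun u _ => ?_
  exact ((F.continuous_coeffInv y w).mul (F.continuous_coeffInv u w)).mul continuous_const

/-- The square of `T w₀` acts by the scalar `q ^ (ℓ(w₀) + c)`. -/
theorem correspondence_T_longest {w₀ : W} (hw₀ : ∀ w, cs.length w ≤ cs.length w₀)
    (χ : GroupIrr W) (q : Set.Ici (1 : ℝ)) (k : ℕ) :
    (F.correspondence q χ).1 ((T cs ((q : ℝ) : ℂ) w₀ ^ 2) ^ k) =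
      χ.dim * (((q : ℝ) : ℂ) ^ ((cs.length w₀ : ℂ) + χ.content cs)) ^ k := by
  classical
  obtain ⟨d, ρ, hd, hρ, hχ⟩ := χ.2
  have hdim : χ.dim = d := by
    rw [GroupIrr.dim, GroupIrr.val, hχ, map_one, map_one, LinearMap.trace_one,
      Module.finrank_fin_fun]
  have hd0 : (d : ℂ) ≠ 0 := by exact_mod_cast hd.ne'
  have hq0 : ∀ q : Set.Ici (1 : ℝ), ((q : ℝ) : ℂ) ≠ 0 := by
    intro q
    have h : (1 : ℝ) ≤ q := q.2
    exact_mod_cast (by linarith : (0 : ℝ) < q).ne'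
  have : Nonempty (Fin d) := ⟨⟨0, hd⟩⟩
  have hscalar : ∀ q : Set.Ici (1 : ℝ), ∃ c : ℂ,
      ρ ((F.iso q).symm (T cs ((q : ℝ) : ℂ) w₀ ^ 2)) = c • 1 := by
    intro q
    refine exists_eq_smul_one_of_commute ρ hρ _ fun a => ?_
    have h := T_longest_sq_central cs ((q : ℝ) : ℂ) hw₀ (F.iso q a)
    have h' := congrArg (fun a => ρ ((F.iso q).symm a)) h
    simpa only [map_mul, AlgEquiv.symm_apply_apply] using h'.symm
  choose c hc using hscalar
  have hval : ∀ q k, (F.correspondence q χ).1 ((T cs ((q : ℝ) : ℂ) w₀ ^ 2) ^ k) = d * c q ^ k := by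
    intro q k
    rw [correspondence_apply, hχ, map_pow, map_pow, hc, smul_pow, one_pow, map_smul,
      LinearMap.trace_one, Module.finrank_fin_fun, smul_eq_mul, mul_comm]
  have hccont : Continuous c := by
    have h1 : c = fun q => (F.correspondence q χ).1 (T cs ((q : ℝ) : ℂ) w₀ ^ 2) / d := by
      funext q
      have := hval q 1
      rw [pow_one, pow_one] at this
      rw [this, mul_div_cancel_left₀ _ hd0]
    rw [h1]
    exact (F.continuous_correspondence_T_sq χ w₀).div_const _
  have hc1 : c ⟨1, Set.self_mem_Ici⟩ = 1 := by
    have h1 := hval ⟨1, Set.self_mem_Ici⟩ 1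
    rw [pow_one, pow_one, pow_two, T_mul_T_of_eq_one cs _ (by simp), cs.longest_mul_self hw₀] at h1
    have h2 := (F.correspondence_isSpecialization χ 1).2
    have h3 : χ.val 1 = d := hdim
    rw [h3] at h2
    have h4 : (d : ℂ) * 1 = d * c ⟨1, Set.self_mem_Ici⟩ := by
      rw [mul_one]
      exact h2.symm.trans h1
    exact (mul_left_cancel₀ hd0 h4).symm
  obtain ⟨ω, hω, hw⟩ := cs.exists_isReduced w₀
  choose m hm hdet using F.exists_det_T_simple χ ρ hχ
  -- Compare determinants: that of the scalar is `c q ^ d`, while that of `T w₀ ^ 2` is a product of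
  -- squared determinants over the reduced word.
  have hcd : ∀ q : Set.Ici (1 : ℝ),
      c q ^ d = ((q : ℝ) : ℂ) ^ (ω.map fun i => 2 * m i).sum := by
    intro q
    have h1 : ∀ ω : List B,
        LinearMap.det (ρ ((F.iso q).symm
          (ω.map fun i => T cs ((q : ℝ) : ℂ) (cs.simple i)).prod)) ^ 2 =
            ((q : ℝ) : ℂ) ^ (ω.map fun i => 2 * m i).sum := by
      intro ω
      induction ω with
      | nil => simp
      | cons i ω ih =>
        rw [List.map_cons, List.prod_cons, map_mul, map_mul, map_mul, mul_pow, ih, hdet,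
          List.map_cons, List.sum_cons, pow_add]
    have h2 := congrArg LinearMap.det (hc q)
    rw [LinearMap.det_smul, map_one, mul_one, Module.finrank_fin_fun] at h2
    rw [← h2, ← h1, prod_map_T_simple cs _ hω, ← hw, map_pow, map_pow, map_pow]
  -- Each letter contributes `2 m = χ(s) + d`; the character values sum to `χ` of the reflection
  -- sum, which is `d` times the content.
  have hsum : (((ω.map fun i => 2 * m i).sum : ℕ) : ℂ) =
      d * ((cs.length w₀ : ℂ) + χ.content cs) := by
    have h1 : (((ω.map fun i => 2 * m i).sum : ℕ) : ℂ) =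
        (ω.map fun i => χ.val (cs.simple i)).sum + d * ω.length := by
      clear hcd hw hω
      induction ω with
      | nil => simp
      | cons i ω ih =>
        rw [List.map_cons, List.sum_cons, Nat.cast_add, ih, List.map_cons, List.sum_cons,
          List.length_cons]
        push_cast
        rw [hm]
        ring
    rw [h1, cs.sum_simple_eq_sum_reflection hw₀ χ.val χ.val_conj hω hw, GroupIrr.content, hdim,
      sum_reflection_val, mul_add, mul_div_cancel₀ _ hd0, hw, hω.eq, add_comm]
  have hcq : ∀ q, c q = ((q : ℝ) : ℂ) ^ ((cs.length w₀ : ℂ) + χ.content cs) := by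
    intro q
    set a := (cs.length w₀ : ℂ) + χ.content cs
    -- Taking the `d`-th root is ambiguous up to a root of unity; continuity in `q` and the value `c
    -- 1 = 1` fix it.
    have hpow : ∀ q : Set.Ici (1 : ℝ), (c q * ((q : ℝ) : ℂ) ^ (-a)) ^ d = 1 := by
      intro q
      rw [mul_pow, hcd, ← Complex.cpow_natCast, hsum, ← Complex.cpow_nat_mul,
        ← Complex.cpow_add _ _ (hq0 q), mul_neg, add_neg_cancel, Complex.cpow_zero]
    have hfin : {z : ℂ | z ^ d = 1}.Finite := by
      refine ((Polynomial.nthRoots d (1 : ℂ)).toFinset.finite_toSet).subset fun z hz => ?_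
      simpa [Polynomial.mem_nthRoots hd] using hz
    have h1 : c q * ((q : ℝ) : ℂ) ^ (-a) =
        c ⟨1, Set.self_mem_Ici⟩ * ((1 : ℝ) : ℂ) ^ (-a) :=
      (hccont.mul (continuous_ofReal_cpow (-a))).eq_of_finite_values hfin hpow q
        ⟨1, Set.self_mem_Ici⟩
    rw [hc1, Complex.ofReal_one, Complex.one_cpow, mul_one] at h1
    rw [Complex.cpow_neg, ← div_eq_mul_inv, div_eq_one_iff_eq] at h1
    · exact h1
    · rw [Complex.cpow_def_of_ne_zero (hq0 q)]
      exact Complex.exp_ne_zero _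
  rw [hval, hcq, hdim]

theorem correspondence_normT_longest {w₀ : W} (hw₀ : ∀ w, cs.length w ≤ cs.length w₀)
    {θ : ℝ} (hθ₀ : 0 < θ) (hq : θ⁻¹ ∈ Set.Ici (1 : ℝ)) (χ : GroupIrr W) (n : ℕ) :
    (F.correspondence ⟨θ⁻¹, hq⟩ χ).1 ((normT cs ((θ⁻¹ : ℝ) : ℂ) w₀ ^ 2) ^ (2 * n)) =
      χ.dim * (θ : ℂ) ^ (2 * (n : ℂ) * ((cs.length w₀ : ℂ) - χ.content cs)) := by
  have hθ : (θ : ℂ) ≠ 0 := by exact_mod_cast hθ₀.ne'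
  have h := F.correspondence_T_longest hw₀ χ ⟨θ⁻¹, hq⟩ (2 * n)
  rw [normT, smul_pow, smul_pow, map_smul, h, smul_eq_mul, mul_left_comm]
  congr 1
  -- Needed for the complex power of `θ⁻¹` to be the inverse of that of `θ`: the base must avoid the
  -- branch cut.
  have harg : (θ : ℂ).arg ≠ Real.pi := by
    rw [Complex.arg_ofReal_of_nonneg hθ₀.le]
    exact Real.pi_ne_zero.symm
  rw [Complex.ofReal_inv, Complex.inv_cpow _ _ harg]
  simp only [inv_pow, inv_inv]
  rw [← pow_mul, ← pow_mul, ← Complex.cpow_nat_mul, ← Complex.cpow_neg, ← Complex.cpow_natCast,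
    ← Complex.cpow_add _ _ hθ]
  congr 1
  push_cast
  ring

/-- The trace form of the Hecke algebra pulled back to the group algebra is a trace. -/
theorem existsUnique_isGenericDegree (q : Set.Ici (1 : ℝ)) :
    ∃! t : GroupIrr W → ℂ, F.correspondence.IsGenericDegree q t := by
  -- Pulled back along `iso q`, the Hecke trace is a trace function on the group algebra, where
  -- orthonormality determines the coefficients.
  have key : ∀ t, F.correspondence.IsGenericDegree q t ↔
      heckeTrace cs ((q : ℝ) : ℂ) ∘ₗ (F.iso q).toLinearMap = ∑ χ : GroupIrr W, t χ • χ.1 := by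
    intro t
    unfold HeckeCorrespondence.IsGenericDegree
    constructor
    · intro h
      refine LinearMap.ext fun a => ?_
      have := LinearMap.congr_fun h (F.iso q a)
      simpa [correspondence_apply] using this
    · intro h
      refine LinearMap.ext fun a => ?_
      have := LinearMap.congr_fun h ((F.iso q).symm a)
      simpa [correspondence_apply] using this
  refine ⟨_, (key _).2 (GroupIrr.eq_sum _ fun a b => ?_), fun t ht => ?_⟩
  · change heckeTrace cs _ (F.iso q (a * b)) = heckeTrace cs _ (F.iso q (b * a))
    rw [heckeTrace_apply, heckeTrace_apply, map_mul (F.iso q), map_mul (F.iso q), tau_mul_comm]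
  · funext ψ
    exact GroupIrr.coeff_eq ((key t).1 ht) ψ

theorem poincare_ofReal (cs : CoxeterSystem M W) (q : ℝ) :
    poincare cs (q : ℂ) = (poincare cs q : ℝ) := by
  simp [poincare]

/-- Evaluate the defining identity at `e = ∑ T w`. Both the Hecke trace and the index representation
give `P_W(q) ≠ 0`, and all other characters vanish at `e`. -/
theorem isGenericDegree_trivial {q : Set.Ici (1 : ℝ)} {t : GroupIrr W → ℂ}
    (ht : F.correspondence.IsGenericDegree q t) : t (GroupIrr.trivial W) = 1 := by
  classical
  have hq : (0 : ℝ) < q := zero_lt_one.trans_le q.2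
  have hq0 : ((q : ℝ) : ℂ) ≠ 0 := by exact_mod_cast hq.ne'
  have hP : poincare cs ((q : ℝ) : ℂ) ≠ 0 := by
    rw [poincare_ofReal]
    exact_mod_cast (poincare_pos cs hq).ne'
  set e : HeckeAlgebra cs ((q : ℝ) : ℂ) := ∑ w, T cs _ w with he
  set e' := (F.iso q).symm e with he'
  have hfix : ∀ w, MonoidAlgebra.of ℂ W w * e' = e' := by
    intro w
    have h1 := mul_sum_T cs ((q : ℝ) : ℂ) hq0 (F.iso q (MonoidAlgebra.of ℂ W w))
    rw [← F.correspondence_trivial, correspondence_apply, AlgEquiv.symm_apply_apply] at h1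
    have h2 : (GroupIrr.trivial W).1 (MonoidAlgebra.of ℂ W w) = 1 := GroupIrr.trivial_val w
    rw [h2, one_smul] at h1
    have h3 := congrArg (F.iso q).symm h1
    rwa [map_mul, AlgEquiv.symm_apply_apply] at h3
  have hvanish : ∀ χ : GroupIrr W, χ ≠ GroupIrr.trivial W → χ.1 e' = 0 := by
    intro χ hχ
    have hc : (Nat.card W : ℂ) ≠ 0 := Nat.cast_ne_zero.2 Nat.card_pos.ne'
    -- As `e'` is fixed by `W`, it is a multiple of the sum of all group elements, on which a
    -- nontrivial irreducible character vanishes by orthogonality.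
    have h1 : (∑ w, MonoidAlgebra.of ℂ W w) * e' = (Nat.card W : ℂ) • e' := by
      rw [Finset.sum_mul, Finset.sum_congr rfl fun w _ => hfix w, Finset.sum_const,
        Finset.card_univ, ← Nat.card_eq_fintype_card, Nat.cast_smul_eq_nsmul]
    have h2 : ∀ a : MonoidAlgebra ℂ W, (∑ w, MonoidAlgebra.of ℂ W w) * a =
        (∑ g, a.coeff g) • ∑ w, MonoidAlgebra.of ℂ W w := by
      intro a
      conv_lhs => rw [MonoidAlgebra.eq_sum_of a, Finset.mul_sum]
      rw [Finset.sum_smul]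
      refine Finset.sum_congr rfl fun g _ => ?_
      rw [mul_smul_comm, Finset.sum_mul]
      congr 1
      simp only [← map_mul]
      exact Equiv.sum_comp (Equiv.mulRight g) fun w => MonoidAlgebra.of ℂ W w
    have h3 : ∑ w, χ.val w = 0 := by
      have h4 := GroupIrr.orthonormal χ (GroupIrr.trivial W)
      simp only [GroupIrr.trivial_val, mul_one, if_neg hχ] at h4
      exact (mul_eq_zero.1 h4).resolve_left (inv_ne_zero hc)
    have h5 := congrArg χ.1 (h1.symm.trans (h2 e'))
    rw [map_smul, map_smul, map_sum] at h5
    have h6 : ∑ w, χ.1 (MonoidAlgebra.of ℂ W w) = 0 := h3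
    rw [h6, smul_zero, smul_eq_mul] at h5
    exact (mul_eq_zero.1 h5).resolve_left hc
  have h1 := LinearMap.congr_fun ht e
  have h2 : index cs ((q : ℝ) : ℂ) e = poincare cs ((q : ℝ) : ℂ) := by
    rw [he, map_sum]
    simp only [index_T, poincare]
  have h3 : heckeTrace cs ((q : ℝ) : ℂ) e = poincare cs ((q : ℝ) : ℂ) := by
    rw [heckeTrace_apply, he, map_sum]
    simp [tau_T]
  rw [h3, LinearMap.sum_apply, Finset.sum_eq_single (GroupIrr.trivial W)] at h1
  · rw [LinearMap.smul_apply, F.correspondence_trivial, h2, smul_eq_mul] at h1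
    exact (mul_right_cancel₀ hP ((one_mul _).trans h1)).symm
  · intro χ _ hχ
    rw [LinearMap.smul_apply, correspondence_apply, hvanish χ hχ, smul_zero]
  · simp

/-- The trace of a left multiplication in terms of the irreducible characters. -/
theorem trace_mulLeft (q : Set.Ici (1 : ℝ)) (a : HeckeAlgebra cs ((q : ℝ) : ℂ)) :
    LinearMap.trace ℂ _ (LinearMap.mulLeft ℂ a) =
      ∑ χ : GroupIrr W, χ.dim * (F.correspondence q χ).1 a := by
  have h := GroupIrr.trace_mulLeft ((F.iso q).symm a)
  have e : LinearMap.mulLeft ℂ a =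
      (F.iso q).toLinearEquiv.conj (LinearMap.mulLeft ℂ ((F.iso q).symm a)) := by
    ext b
    simp [LinearEquiv.conj_apply]
  rw [e, LinearMap.trace_conj', h]
  rfl

theorem trace_mulLeft_eq_sum_repr (cs : CoxeterSystem M W) (q : ℂ) (a : HeckeAlgebra cs q) :
    LinearMap.trace ℂ _ (LinearMap.mulLeft ℂ a) =
      ∑ x, (basisT cs q).repr (a * T cs q x) x := by
  classical
  rw [LinearMap.trace_eq_matrix_trace ℂ (basisT cs q), Matrix.trace]
  refine Finset.sum_congr rfl fun x _ => ?_
  rw [Matrix.diag_apply, LinearMap.toMatrix_apply, LinearMap.mulLeft_apply]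
  rfl

end HeckeTrivialization

theorem HeckeAlgebra.index_normT_sq_pow {B W F : Type*} [Group W] [Field F] {M : CoxeterMatrix B}
    (cs : CoxeterSystem M W) {q : F} (hq : q ≠ 0) (w : W) (n : ℕ) :
    index cs q ((normT cs q w ^ 2) ^ n) = 1 := by
  rw [map_pow, map_pow, index_normT cs q hq, one_pow, one_pow]

/-! ### Return probabilities and the two formulas -/

section ReturnProbability

variable {B W : Type*} [Group W] [Fintype W] [DecidableEq W] {M : CoxeterMatrix B}
  (cs : CoxeterSystem M W)

/-- The return probabilities of the chain are coefficients in the complex Hecke algebra. -/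
theorem HeckeAlgebra.ofReal_leftMulChain_pow_self {q : ℝ} (hq : q ≠ 0) (w x : W) (n : ℕ) :
    (((leftMulChain cs q (normT cs q w ^ 2) ^ n) x x : ℝ) : ℂ) =
      (basisT cs (q : ℂ)).repr ((normT cs (q : ℂ) w ^ 2) ^ n * T cs (q : ℂ) x) x := by
  rw [← leftMulChain_pow cs q hq, leftMulChain_self cs q hq, ← repr_mapC, map_mul, map_pow,
    map_pow, mapC_normT, mapC_T]

end ReturnProbability

theorem theorem4p10 {B W : Type*} [Group W] [Fintype W] [DecidableEq W] {M : CoxeterMatrix B}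
    (cs : CoxeterSystem M W) (θ : ℝ) (hθ₀ : 0 < θ) (hθ₁ : θ ≤ 1)
    (w₀ : W) (hw₀ : ∀ w, cs.length w ≤ cs.length w₀)
    (K : Matrix W W ℝ) (hK : K = leftMulChain cs θ⁻¹ (normT cs θ⁻¹ w₀ ^ 2)) :
    IsReversibleChain (lengthDist cs θ) K ∧
    (∃! X : HeckeCorrespondence cs, X.IsSpecialization) ∧
    (∀ X : HeckeCorrespondence cs, X.IsSpecialization →
      (∃! t : GroupIrr W → ℂ, X.IsGenericDegree ⟨θ⁻¹, (one_le_inv₀ hθ₀).2 hθ₁⟩ t) ∧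
      ∀ t : GroupIrr W → ℂ, X.IsGenericDegree ⟨θ⁻¹, (one_le_inv₀ hθ₀).2 hθ₁⟩ t → ∀ n : ℕ,
        (chainDistSq (lengthDist cs θ) K 1 n : ℂ) =
          ∑ χ : GroupIrr W with χ ≠ GroupIrr.trivial W,
            t χ * χ.dim * (θ : ℂ) ^ (2 * (n : ℂ) * ((cs.length w₀ : ℂ) - χ.content cs))) ∧
    ∀ n : ℕ,
      ((∑ x : W, lengthDist cs θ x * chainDistSq (lengthDist cs θ) K x n : ℝ) : ℂ) =
        ∑ χ : GroupIrr W with χ ≠ GroupIrr.trivial W,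
          χ.dim ^ 2 * (θ : ℂ) ^ (2 * (n : ℂ) * ((cs.length w₀ : ℂ) - χ.content cs)) := by
  obtain ⟨F⟩ := HeckeTrivialization.nonempty cs
  have hq : 0 < θ⁻¹ := inv_pos.2 hθ₀
  have hqC : ((θ⁻¹ : ℝ) : ℂ) ≠ 0 := by exact_mod_cast hq.ne'
  have hP := poincare_pos cs hq
  have hrev : IsReversibleChain (lengthDist cs θ) K :=
    hK ▸ isReversibleChain_leftMulChain cs hθ₀ hθ₁ hw₀
  have hμ : ∀ x, 0 < lengthDist cs θ x := fun x => by unfold lengthDist; positivity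
  have hsplit : ∀ f : GroupIrr W → ℂ, ∑ χ, f χ =
      f (GroupIrr.trivial W) + ∑ χ : GroupIrr W with χ ≠ GroupIrr.trivial W, f χ := by
    intro f
    rw [Finset.filter_ne', Finset.add_sum_erase _ _ (Finset.mem_univ _)]
  have hpow : ∀ (x : W) (n : ℕ), (((K ^ (2 * n)) x x : ℝ) : ℂ) =
      (basisT cs ((θ⁻¹ : ℝ) : ℂ)).repr
        ((normT cs ((θ⁻¹ : ℝ) : ℂ) w₀ ^ 2) ^ (2 * n) * T cs ((θ⁻¹ : ℝ) : ℂ) x) x :=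
    fun x n => hK ▸ ofReal_leftMulChain_pow_self cs hq.ne' w₀ x (2 * n)
  refine ⟨hrev, HeckeTrivialization.existsUnique_isSpecialization cs, fun X hX => ?_, fun n => ?_⟩
  · obtain rfl := F.eq_correspondence_of_isSpecialization hX
    refine ⟨F.existsUnique_isGenericDegree _, fun t ht n => ?_⟩
    have h1 := LinearMap.congr_fun ht ((normT cs ((θ⁻¹ : ℝ) : ℂ) w₀ ^ 2) ^ (2 * n))
    rw [LinearMap.sum_apply, hsplit, LinearMap.smul_apply, F.correspondence_trivial,
      index_normT_sq_pow cs hqC, F.isGenericDegree_trivial ht, smul_eq_mul, mul_one] at h1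
    -- Dividing by `π(1) = 1 / P_W(θ⁻¹)` supplies the factor that turns `tau` into `heckeTrace`.
    have h2 : (chainDistSq (lengthDist cs θ) K 1 n : ℂ) =
        heckeTrace cs ((θ⁻¹ : ℝ) : ℂ) ((normT cs ((θ⁻¹ : ℝ) : ℂ) w₀ ^ 2) ^ (2 * n)) - 1 := by
      rw [hrev.chainDistSq_eq hμ, Complex.ofReal_sub, Complex.ofReal_div, hpow, lengthDist,
        cs.length_one, pow_zero, heckeTrace_apply, HeckeTrivialization.poincare_ofReal,
        ← one_def, mul_one, Complex.ofReal_div, Complex.ofReal_one, div_div_eq_mul_div, div_one,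
        mul_comm]
      rfl
    rw [h2, h1, add_sub_cancel_left]
    refine Finset.sum_congr rfl fun χ _ => ?_
    rw [LinearMap.smul_apply, smul_eq_mul, mul_assoc]
    exact congrArg (t χ * ·) (F.correspondence_normT_longest hw₀ hθ₀ _ χ n)
  · have h1 := F.trace_mulLeft ⟨θ⁻¹, (one_le_inv₀ hθ₀).2 hθ₁⟩
      ((normT cs ((θ⁻¹ : ℝ) : ℂ) w₀ ^ 2) ^ (2 * n))
    rw [HeckeTrivialization.trace_mulLeft_eq_sum_repr, hsplit, F.correspondence_trivial,
      index_normT_sq_pow cs hqC, GroupIrr.dim, GroupIrr.trivial_val, mul_one] at h1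
    -- The weights `π(x)` cancel the denominators of the return probabilities, leaving the trace of
    -- `K^(2n)` minus the total mass `1`.
    have h2 : ∑ x, lengthDist cs θ x * chainDistSq (lengthDist cs θ) K x n =
        ∑ x, (K ^ (2 * n)) x x - 1 := by
      rw [← hrev.1.2, ← Finset.sum_sub_distrib]
      refine Finset.sum_congr rfl fun x _ => ?_
      rw [hrev.chainDistSq_eq hμ, mul_sub, mul_one, mul_div_cancel₀ _ (hμ x).ne']
    rw [h2, Complex.ofReal_sub, Complex.ofReal_sum, Finset.sum_congr rfl fun x _ => hpow x n, h1,
      Complex.ofReal_one, add_sub_cancel_left]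
    refine Finset.sum_congr rfl fun χ _ => ?_
    rw [pow_two χ.dim, mul_assoc]
    have h3 := F.correspondence_normT_longest hw₀ hθ₀ ((one_le_inv₀ hθ₀).2 hθ₁) χ n
    exact congrArg (fun z => χ.dim * z) h3
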